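/- Let $\{a(p,q):1\le p\le q<\infty\}$ be real random variables on a probability space $(\Omega,\mathcal F,\mathbb P)$ such that $\mathbb E[a(p,q)]=0$ and $\mathbb E[a(p,q)^2]=1$ for all $p\le q$, and $\sup_{p\le q}\mathbb E|a(p,q)|^k<\infty$ for every $k\in\mathbb N$. Assume that the diagonals $Z^{(r)}=(a(p,p+r))_{p\ge 1}$, $r=0,1,2,\dots$, are independent of one another and that each $Z^{(r)}$ is a stationary process. Let $\mathbf X_n$ be the symmetric $n\times n$ matrix with $\mathbf X_n(p,q)=\mathbf X_n(q,p)=a(p,q)/\sqrt n$ for $1\le p\le q\le n$, let $\lambda_1^{(n)},\dots,\lambda_n^{(n)}$ be its eigenvalues, counted with multiplicity, and let $\mu_n=\frac1n\sum_{k=1}^n\delta_{\lambda_k^{(n)}}$ be its empirical spectral distribution. Let $\mu$ be the semicircle distribution, with density $\frac1{2\pi}\sqrt{4-x^2}\,\mathbf 1_{[-2,2]}(x)$. Write $\mathrm{Cov}_r(t)=\mathbb E[Z^{(r)}_1Z^{(r)}_{1+t}]$. 1. Suppose that every $Z^{(r)}$ is ergodic and that the correlations decay to $0$ uniformly over the diagonals,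 i.e. $\sup_{r\ge 0}|\mathrm{Cov}_r(t)|\to 0$ as $t\to\infty$. Then $\mu_n$ converges weakly to $\mu$ in expectation, i.e. $\mathbb E\left[\int f\,d\mu_n\right]\to\int f\,d\mu$ for every bounded continuous $f:\mathbb R\to\mathbb R$, and $\mathbb P$-almost surely $\mu_n$ converges weakly to $\mu$. 2. Suppose instead that the correlations all have the same sign and are bounded away from $0$, i.e. there is $c>0$ such that either $\mathrm{Cov}_r(t)\ge c$ for all $r\ge0$, $t\ge1$, or $\mathrm{Cov}_r(t)\le -c$ for all $r\ge0$, $t\ge1$ (ergodicity is not assumed here). Then $\mu_n$ does not converge to $\mu$: it does not converge weakly to $\mu$ in expectation, and $\mathbb P$-almost surely $\mu_n$ does not converge weakly to $\mu$. Moreover, there is $\delta>0$ such that $\mathbb E\left[\int x^4\,d\mu_n\right]\ge\int x^4\,d\mu+\delta$ for all sufficiently large $n$. -/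

import Mathlib

open MeasureTheory ProbabilityTheory Filter Topology
open scoped ENNReal BoundedContinuousFunction

namespace ErgodicSemicircle

noncomputable section

/-- The semicircle distribution, with density `(2π)⁻¹ √(4 - x²)` on `[-2, 2]`. -/
def semicircle : Measure ℝ :=
  (volume.restrict (Set.Icc (-2 : ℝ) 2)).withDensity
    fun x => ENNReal.ofReal (1 / (2 * Real.pi) * Real.sqrt (4 - x ^ 2))

instance semicircle_isFiniteMeasure : IsFiniteMeasure semicircle := by
  refine isFiniteMeasure_withDensity_ofReal ?_
  have h : IntegrableOn (fun x : ℝ => 1 / (2 * Real.pi) * Real.sqrt (4 - x ^ 2))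
      (Set.Icc (-2 : ℝ) 2) volume :=
    ContinuousOn.integrableOn_compact isCompact_Icc (by fun_prop)
  exact h.2

variable {Ω : Type*}

/-- The `r`-th diagonal `p ↦ a(p, p + r)` of the array, as a random sequence. Rows and columns
are numbered from `0`. -/
def diagonal (a : ℕ → ℕ → Ω → ℝ) (r : ℕ) (ω : Ω) : ℕ → ℝ := fun p => a p (p + r) ω

/-- The left shift on real sequences. -/
def shift (x : ℕ → ℝ) : ℕ → ℝ := fun p => x (p + 1)

/-- The law of the `r`-th diagonal on sequence space. -/
def diagonalLaw [MeasurableSpace Ω] (P : Measure Ω) (a : ℕ → ℕ → Ω → ℝ) (r : ℕ) :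
    Measure (ℕ → ℝ) :=
  P.map (diagonal a r)

/-- The standing assumptions on the array `a(p, q)`, `p ≤ q`: centred, unit variance, moments of
every order bounded uniformly in `(p, q)`, independent diagonals, each of them stationary.
The values `a p q` with `q < p` are irrelevant. -/
structure IsDiagonalArray [MeasurableSpace Ω] (P : Measure Ω) (a : ℕ → ℕ → Ω → ℝ) : Prop where
  measurable : ∀ p q, p ≤ q → Measurable (a p q)
  mean_zero : ∀ p q, p ≤ q → ∫ ω, a p q ω ∂P = 0
  unit_variance : ∀ p q, p ≤ q → ∫ ω, a p q ω ^ 2 ∂P = 1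
  moments : ∀ k : ℕ, ∃ C : ℝ, ∀ p q, p ≤ q →
    Integrable (fun ω => |a p q ω| ^ k) P ∧ ∫ ω, |a p q ω| ^ k ∂P ≤ C
  indep : iIndepFun (diagonal a) P
  stationary : ∀ r, MeasurePreserving shift (diagonalLaw P a r) (diagonalLaw P a r)

/-- Every diagonal is an ergodic process: the shift is ergodic for its law. -/
def ErgodicDiagonals [MeasurableSpace Ω] (P : Measure Ω) (a : ℕ → ℕ → Ω → ℝ) : Prop :=
  ∀ r, Ergodic shift (diagonalLaw P a r)

/-- The correlation at distance `t` along the `r`-th diagonal (the entries are centred with unit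
variance). -/
def corr [MeasurableSpace Ω] (P : Measure Ω) (a : ℕ → ℕ → Ω → ℝ) (r t : ℕ) : ℝ :=
  ∫ ω, a 0 r ω * a t (t + r) ω ∂P

/-- The correlations along the diagonals tend to `0` as the distance grows, uniformly over the
diagonals. -/
def CorrDecay [MeasurableSpace Ω] (P : Measure Ω) (a : ℕ → ℕ → Ω → ℝ) : Prop :=
  TendstoUniformly (fun t r => corr P a r t) (fun _ => 0) atTop

/-- The correlations at positive distance all have the same sign and are bounded away from `0`. -/
def CorrBoundedAway [MeasurableSpace Ω] (P : Measure Ω) (a : ℕ → ℕ → Ω → ℝ) : Prop :=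
  ∃ c : ℝ, 0 < c ∧
    ((∀ r t, 1 ≤ t → c ≤ corr P a r t) ∨ (∀ r t, 1 ≤ t → corr P a r t ≤ -c))

/-- The symmetric `n × n` matrix with entries `a(p, q) / √n` for `p ≤ q`. -/
def X (a : ℕ → ℕ → Ω → ℝ) (n : ℕ) (ω : Ω) : Matrix (Fin n) (Fin n) ℝ :=
  Matrix.of fun i j => a (min i j : ℕ) (max i j : ℕ) ω / Real.sqrt n

theorem X_isHermitian (a : ℕ → ℕ → Ω → ℝ) (n : ℕ) (ω : Ω) : (X a n ω).IsHermitian := by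
  ext i j
  simp [X, min_comm, max_comm]

/-- The empirical spectral distribution of `X a n ω` (the zero measure if `n = 0`). -/
def esd (a : ℕ → ℕ → Ω → ℝ) (n : ℕ) (ω : Ω) : Measure ℝ :=
  (n : ℝ≥0∞)⁻¹ • ∑ k : Fin n, Measure.dirac ((X_isHermitian a n ω).eigenvalues k)

instance esd_isFiniteMeasure (a : ℕ → ℕ → Ω → ℝ) (n : ℕ) (ω : Ω) :
    IsFiniteMeasure (esd a n ω) := by
  rcases Nat.eq_zero_or_pos n with rfl | h
  · constructor
    simp [esd]
  · constructor
    have h0 : (n : ℝ≥0∞) ≠ 0 := by exact_mod_cast h.ne'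
    simp [esd, ENNReal.inv_mul_cancel h0 (ENNReal.natCast_ne_top n)]

/-- The semicircle distribution as a point of Mathlib's space of finite measures, which carries
the topology of weak convergence. -/
def semicircleFM : FiniteMeasure ℝ := ⟨semicircle, semicircle_isFiniteMeasure⟩

/-- The ESD as a point of the space of finite measures. -/
def esdFM (a : ℕ → ℕ → Ω → ℝ) (n : ℕ) (ω : Ω) : FiniteMeasure ℝ :=
  ⟨esd a n ω, esd_isFiniteMeasure a n ω⟩

/-- Weak convergence of the ESD at the sample point `ω` to the semicircle law. -/
def ESDConvergesAt (a : ℕ → ℕ → Ω → ℝ) (ω : Ω) : Prop :=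
  Tendsto (fun n => esdFM a n ω) atTop (𝓝 semicircleFM)

/-- Weak convergence of the expected ESD to the semicircle law: the expected ESD integrates a
bounded continuous `f` to the expectation of `∫ f dμₙ`. -/
def ESDConvergesInExpectation [MeasurableSpace Ω] (P : Measure Ω) (a : ℕ → ℕ → Ω → ℝ) : Prop :=
  ∀ f : ℝ →ᵇ ℝ, Tendsto (fun n => ∫ ω, ∫ x, f x ∂(esd a n ω) ∂P) atTop
    (𝓝 (∫ x, f x ∂semicircle))

end

end ErgodicSemicircle

namespace ErgodicSemicircle

/-! ### Traces of powers and closed walks -/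

/-! The proof is the moment method. The `K`-th moment of the ESD is `√n ^ (-(K + 2))` times a sum
over closed walks of length `K` of the product of the entries along the walk. The entry used by a
step lies on the diagonal indexed by the length of that step, so independence and centring kill
every walk that takes some step length only once. A walk is given by its start and its signed steps.
With at most `j` distinct lengths there are `O(n ^ (j + 1))` walks, and a non-trivial linear
relation between the lengths costs a factor `n` (`card_le_of_linear_constraint`). Hence only walks
whose lengths occur exactly in pairs matter, and closing up forces the two steps of a pair to be
opposite, up to negligible walks.

Now pair the first step with its partner. If the partner retraces the first step, this contributes
`E[a²] = 1` and cuts the rest into two closed walks, whose total weight is an expected product of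
two shorter traces. Otherwise the walk is crossing, and the pair contributes a correlation at a
non-zero distance along a diagonal. This is the recursion `exists_integral_tracePow_succ`. The
variance of a moment of the ESD is `O(1/n)` (`exists_tracePow_variance_le`), so expected products
factorize in the limit.

If correlations decay uniformly, crossing walks are negligible (`exists_abs_sum_crossingWalks_le`):
distances above a threshold give small factors, and each smaller distance is an extra linear
constraint. What remains is the Catalan recursion `semicircleMoment_succ`. The variance bound is
summable along `n = m ^ 2`, which gives almost sure convergence there. Convex functions of nested
symmetric matrices have monotone traces (`sum_eigenvalues_submatrix_le`), which fills in the sizes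
between squares. Convergence in expectation then follows by domination.

If correlations stay away from `0` with one sign, the recursion for the fourth moment has a surplus:
about `n ^ 3` parallelograms, each weighted by a product of two correlations of equal sign, hence at
least `c ^ 2` (`exists_fourth_moment_gap`). Bounded expected sixth moments turn this gap into a gap
for a bounded continuous test function, in expectation and almost surely along the squares. -/

theorem pow_apply_eq_sum_walks {m : Type*} [Fintype m] [DecidableEq m] (A : Matrix m m ℝ) (K : ℕ)
    (x y : m) :
    (A ^ K) x y = ∑ p : Fin (K + 1) → m, if p 0 = x ∧ p (Fin.last K) = y then
      ∏ i : Fin K, A (p i.castSucc) (p i.succ) else 0 := by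
  induction K generalizing x with
  | zero =>
    rw [← (Equiv.funUnique (Fin 1) m).symm.sum_comp]
    simp only [pow_zero, Matrix.one_apply]
    by_cases h : x = y
    · subst h; simp
    · rw [if_neg h, eq_comm]
      refine Finset.sum_eq_zero fun z _ => if_neg ?_
      rintro ⟨h1, h2⟩
      exact h (h1.symm.trans h2)
  | succ K ih =>
    rw [pow_succ', Matrix.mul_apply, ← (Fin.consEquiv fun _ => m).sum_comp, Fintype.sum_prod_type,
      Finset.sum_comm]
    simp_rw [ih, Finset.mul_sum]
    rw [Finset.sum_comm]
    refine Finset.sum_congr rfl fun q _ => ?_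
    rw [Finset.sum_eq_single (q 0), Finset.sum_eq_single x]
    · simp [Fin.consEquiv, Fin.prod_univ_succ, ← Fin.succ_last, mul_ite]
    · intro w _ hw
      simp [Fin.consEquiv, hw]
    · simp
    · intro w _ hw
      simp [hw.symm]
    · simp

/-- The closed walks of length `K` on the vertices `0, …, n - 1`. -/
def closedWalks (n K : ℕ) : Finset (Fin (K + 1) → Fin n) :=
  Finset.univ.filter fun p => p 0 = p (Fin.last K)

theorem trace_pow_eq_sum_closedWalks {n : ℕ} (A : Matrix (Fin n) (Fin n) ℝ) (K : ℕ) :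
    (A ^ K).trace = ∑ p ∈ closedWalks n K, ∏ i : Fin K, A (p i.castSucc) (p i.succ) := by
  simp only [Matrix.trace, Matrix.diag_apply, pow_apply_eq_sum_walks, closedWalks,
    Finset.sum_filter]
  rw [Finset.sum_comm]
  refine Finset.sum_congr rfl fun p _ => ?_
  rw [Finset.sum_eq_single (p 0)]
  · simp [eq_comm]
  · intro w _ hw
    simp [hw.symm]
  · simp

/-! ### Spectral statistics -/

theorem trace_pow_eq_sum_eigenvalues {m : Type*} [Fintype m] [DecidableEq m] {A : Matrix m m ℝ}
    (hA : A.IsHermitian) (K : ℕ) : (A ^ K).trace = ∑ i, hA.eigenvalues i ^ K := by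
  conv_lhs => rw [hA.spectral_theorem]
  rw [← map_pow, Unitary.conjStarAlgAut_apply, Matrix.trace_mul_cycle]
  simp [Matrix.diagonal_pow]

/-- A real symmetric matrix in the form `U D Uᵀ`. -/
theorem exists_orthogonal_diagonalization {m : Type*} [Fintype m] [DecidableEq m]
    {A : Matrix m m ℝ} (hA : A.IsHermitian) :
    ∃ U : Matrix m m ℝ, U.transpose * U = 1 ∧ U * U.transpose = 1 ∧
      A = U * Matrix.diagonal hA.eigenvalues * U.transpose := by
  refine ⟨hA.eigenvectorUnitary, ?_, ?_, ?_⟩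
  · have := Unitary.coe_star_mul_self hA.eigenvectorUnitary
    simpa [Matrix.star_eq_conjTranspose] using this
  · have := Unitary.coe_mul_star_self hA.eigenvectorUnitary
    simpa [Matrix.star_eq_conjTranspose] using this
  · conv_lhs => rw [hA.spectral_theorem]
    rw [Unitary.conjStarAlgAut_apply]
    simp [Matrix.star_eq_conjTranspose]

/-- Compressing a symmetric matrix to a subset of the coordinates decreases the trace of a
nonnegative convex function of it. -/
theorem sum_eigenvalues_submatrix_le {m l : Type*} [Fintype m] [DecidableEq m] [Fintype l]
    [DecidableEq l] {A : Matrix m m ℝ} (hA : A.IsHermitian) {B : Matrix l l ℝ}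
    (hB : B.IsHermitian) (e : l → m) (he : Function.Injective e) (hBA : B = A.submatrix e e)
    {f : ℝ → ℝ} (hf : ConvexOn ℝ Set.univ f) (hf0 : ∀ x, 0 ≤ f x) :
    ∑ i, f (hB.eigenvalues i) ≤ ∑ j, f (hA.eigenvalues j) := by
  obtain ⟨U, hU, hU', hAU⟩ := exists_orthogonal_diagonalization hA
  obtain ⟨V, hV, hV', hBV⟩ := exists_orthogonal_diagonalization hB
  set DA := Matrix.diagonal hA.eigenvalues
  set DB := Matrix.diagonal hB.eigenvalues with hDB
  set Q : Matrix m l ℝ := (1 : Matrix m m ℝ).submatrix id e with hQ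
  have hQQ : Q.transpose * Q = 1 := by
    ext i j
    simp [hQ, Matrix.mul_apply, Matrix.one_apply, he.eq_iff]
  have hQA : Q.transpose * A * Q = B := by
    rw [hQ, Matrix.transpose_submatrix, Matrix.transpose_one, hBA]
    have h1 : (1 : Matrix m m ℝ).submatrix e id * A = A.submatrix e id := by
      ext i j; simp [Matrix.mul_apply, Matrix.one_apply]
    rw [h1]
    ext i j; simp [Matrix.mul_apply, Matrix.one_apply]
  -- The columns of `W` are the eigenvectors of `B` in the eigenbasis of `A`. Each eigenvalue of `B`
  -- is then an average of eigenvalues of `A` with weights `W j i ^ 2`, and Jensen applies.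
  set W : Matrix m l ℝ := U.transpose * Q * V with hW
  have hWt : W.transpose = V.transpose * Q.transpose * U := by
    simp [hW, Matrix.transpose_mul, Matrix.mul_assoc]
  have hWW : W.transpose * W = 1 := by
    calc W.transpose * W = V.transpose * (Q.transpose * ((U * U.transpose) * Q)) * V := by
          rw [hWt, hW]; simp only [Matrix.mul_assoc]
      _ = 1 := by rw [hU', Matrix.one_mul, hQQ, Matrix.mul_one, hV]
  have hWD : W.transpose * DA * W = DB := by
    calc W.transpose * DA * W
        = V.transpose * (Q.transpose * (U * DA * U.transpose) * Q) * V := by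
          rw [hWt, hW]; simp only [Matrix.mul_assoc]
      _ = V.transpose * (V * DB * V.transpose) * V := by rw [← hAU, hQA, ← hBV]
      _ = (V.transpose * V) * DB * (V.transpose * V) := by simp only [Matrix.mul_assoc]
      _ = DB := by rw [hV]; simp
  have hcol (i : l) : ∑ j, W j i ^ 2 = 1 := by
    have := congrFun (congrFun hWW i) i
    rw [Matrix.mul_apply, Matrix.one_apply_eq] at this
    simpa [Matrix.transpose_apply, ← pow_two] using this
  have hval (i : l) : ∑ j, W j i ^ 2 * hA.eigenvalues j = hB.eigenvalues i := by
    have := congrFun (congrFun hWD i) i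
    rw [hDB, Matrix.diagonal_apply_eq, Matrix.mul_apply] at this
    rw [← this]
    refine Finset.sum_congr rfl fun j _ => ?_
    rw [Matrix.mul_diagonal, Matrix.transpose_apply]
    ring
  -- `W * Wᵀ` is a symmetric idempotent, so a diagonal entry `d` equals the sum of squares of its
  -- row. Thus `d ^ 2 ≤ d`, that is `d ≤ 1`.
  have hrow (j : m) : ∑ i, W j i ^ 2 ≤ 1 := by
    have hidem : (W * W.transpose) * (W * W.transpose) = W * W.transpose := by
      rw [Matrix.mul_assoc, ← Matrix.mul_assoc W.transpose, hWW, Matrix.one_mul]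
    have hsymm (k : m) : (W * W.transpose) k j = (W * W.transpose) j k := by
      rw [Matrix.mul_apply, Matrix.mul_apply]
      exact Finset.sum_congr rfl fun _ _ => mul_comm _ _
    have hx : ∑ i, W j i ^ 2 = (W * W.transpose) j j := by
      rw [Matrix.mul_apply]
      exact Finset.sum_congr rfl fun _ _ => by rw [Matrix.transpose_apply, pow_two]
    have hsq : (W * W.transpose) j j = ∑ k, (W * W.transpose) j k ^ 2 := by
      conv_lhs => rw [← hidem, Matrix.mul_apply]
      exact Finset.sum_congr rfl fun k _ => by rw [hsymm, pow_two]
    have hle : (W * W.transpose) j j ^ 2 ≤ (W * W.transpose) j j := by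
      conv_rhs => rw [hsq]
      exact Finset.single_le_sum (f := fun k => (W * W.transpose) j k ^ 2)
        (fun k _ => sq_nonneg _) (Finset.mem_univ j)
    rw [hx]
    nlinarith [sq_nonneg ((W * W.transpose) j j - 1)]
  calc ∑ i, f (hB.eigenvalues i) ≤ ∑ i, ∑ j, W j i ^ 2 * f (hA.eigenvalues j) := by
        refine Finset.sum_le_sum fun i _ => ?_
        rw [← hval i]
        have := hf.map_sum_le (t := Finset.univ) (w := fun j => W j i ^ 2)
          (p := hA.eigenvalues) (fun _ _ => sq_nonneg _) (hcol i) (fun _ _ => Set.mem_univ _)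
        simpa [smul_eq_mul] using this
    _ = ∑ j, (∑ i, W j i ^ 2) * f (hA.eigenvalues j) := by
        rw [Finset.sum_comm]
        simp_rw [Finset.sum_mul]
    _ ≤ ∑ j, f (hA.eigenvalues j) := by
        refine Finset.sum_le_sum fun j _ => ?_
        exact mul_le_of_le_one_left (hf0 _) (hrow j)

section Spectral

variable {Ω : Type*}

theorem integral_esd (a : ℕ → ℕ → Ω → ℝ) (n : ℕ) (ω : Ω) (f : ℝ → ℝ) :
    ∫ x, f x ∂(esd a n ω) = (n : ℝ)⁻¹ * ∑ k, f ((X_isHermitian a n ω).eigenvalues k) := by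
  rw [esd, integral_smul_measure, integral_finsetSum_measure]
  · simp
  · intro i _
    exact integrable_dirac (by simp)

theorem integrable_esd (a : ℕ → ℕ → Ω → ℝ) (n : ℕ) (ω : Ω) (f : ℝ → ℝ) :
    Integrable f (esd a n ω) := by
  rcases Nat.eq_zero_or_pos n with rfl | h
  · simp [esd]
  · refine Integrable.smul_measure ?_ (by simp [h.ne'])
    rw [integrable_finsetSum_measure]
    intro i _
    exact integrable_dirac (by simp)

theorem integral_pow_esd (a : ℕ → ℕ → Ω → ℝ) (n : ℕ) (ω : Ω) (K : ℕ) :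
    ∫ x, x ^ K ∂(esd a n ω) = (n : ℝ)⁻¹ * (X a n ω ^ K).trace := by
  rw [integral_esd, trace_pow_eq_sum_eigenvalues (X_isHermitian a n ω)]

/-- The entry of the symmetric array `a(p, q)`, without normalization. -/
def entry (a : ℕ → ℕ → Ω → ℝ) (x y : ℕ) (ω : Ω) : ℝ := a (min x y) (max x y) ω

/-- The product of the entries along a walk. -/
def walkWeight (a : ℕ → ℕ → Ω → ℝ) {n K : ℕ} (p : Fin (K + 1) → Fin n) (ω : Ω) : ℝ :=
  ∏ i : Fin K, entry a (p i.castSucc) (p i.succ) ω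

/-- The trace of the `K`-th power of the matrix without normalization. -/
def tracePow (a : ℕ → ℕ → Ω → ℝ) (n K : ℕ) (ω : Ω) : ℝ :=
  ∑ p ∈ closedWalks n K, walkWeight a p ω

/-- The two extra factors `√n` are the mass `1/n` of each eigenvalue. Powers of `√n` treat even and
odd `K` alike. -/
theorem integral_pow_esd_eq (a : ℕ → ℕ → Ω → ℝ) (n : ℕ) (ω : Ω) (K : ℕ) :
    ∫ x, x ^ K ∂(esd a n ω) = tracePow a n K ω / Real.sqrt n ^ (K + 2) := by
  rw [integral_pow_esd, trace_pow_eq_sum_closedWalks, tracePow]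
  have h (p : Fin (K + 1) → Fin n) : ∏ i : Fin K, X a n ω (p i.castSucc) (p i.succ) =
      walkWeight a p ω / Real.sqrt n ^ K := by
    simp [X, walkWeight, entry, Finset.prod_div_distrib]
  simp_rw [h]
  rw [← Finset.sum_div, pow_add, Real.sq_sqrt (Nat.cast_nonneg n)]
  ring

end Spectral

/-! ### Moments of the semicircle distribution -/

theorem integral_semicircle (f : ℝ → ℝ) :
    ∫ x, f x ∂semicircle =
      1 / (2 * Real.pi) * ∫ x in (-2 : ℝ)..2, f x * Real.sqrt (4 - x ^ 2) := by
  rw [semicircle, integral_withDensity_eq_integral_toReal_smul (by fun_prop) (by simp),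
    intervalIntegral.integral_of_le (by norm_num), ← integral_Icc_eq_integral_Ioc,
    ← integral_const_mul]
  refine integral_congr_ae (ae_of_all _ fun x => ?_)
  have : 0 ≤ 1 / (2 * Real.pi) * Real.sqrt (4 - x ^ 2) := by positivity
  simp only [ENNReal.toReal_ofReal this, smul_eq_mul]
  ring

theorem integrable_semicircle {f : ℝ → ℝ} (hf : Continuous f) : Integrable f semicircle := by
  rw [semicircle, integrable_withDensity_iff_integrable_smul' (by fun_prop) (by simp)]
  have h : IntegrableOn (fun x : ℝ => (1 / (2 * Real.pi) * Real.sqrt (4 - x ^ 2)) * f x)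
      (Set.Icc (-2 : ℝ) 2) volume :=
    ContinuousOn.integrableOn_compact isCompact_Icc (by fun_prop)
  refine h.congr (ae_of_all _ fun x => ?_)
  have : 0 ≤ 1 / (2 * Real.pi) * Real.sqrt (4 - x ^ 2) := by positivity
  simp only [ENNReal.toReal_ofReal this, smul_eq_mul]

/-- The function `x ^ (k + 1) * (4 - x ^ 2) ^ (3/2)` vanishes at `±2`, and its derivative is the
difference of the two integrands. -/
theorem integral_pow_mul_sqrt_step (k : ℕ) :
    (k + 4 : ℝ) * ∫ x in (-2 : ℝ)..2, x ^ (k + 2) * Real.sqrt (4 - x ^ 2) =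
      4 * (k + 1) * ∫ x in (-2 : ℝ)..2, x ^ k * Real.sqrt (4 - x ^ 2) := by
  have hd : ∀ x ∈ Set.Ioo (-2 : ℝ) 2,
      HasDerivAt (fun x : ℝ => x ^ (k + 1) * ((4 - x ^ 2) * Real.sqrt (4 - x ^ 2)))
        (4 * (k + 1) * (x ^ k * Real.sqrt (4 - x ^ 2)) -
          (k + 4) * (x ^ (k + 2) * Real.sqrt (4 - x ^ 2))) x := by
    intro x hx
    have hpos : 0 < 4 - x ^ 2 := by nlinarith [hx.1, hx.2]
    have h1 : HasDerivAt (fun x : ℝ => 4 - x ^ 2) (-(2 * x)) x := by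
      simpa using (hasDerivAt_pow 2 x).const_sub 4
    have h2 := h1.sqrt hpos.ne'
    have h3 := (hasDerivAt_pow (k + 1) x).mul (h1.mul h2)
    refine h3.congr_deriv ?_
    have hs : Real.sqrt (4 - x ^ 2) ≠ 0 := (Real.sqrt_pos.2 hpos).ne'
    have hq : Real.sqrt (4 - x ^ 2) ^ 2 = 4 - x ^ 2 := Real.sq_sqrt hpos.le
    simp only [Pi.mul_apply, Nat.cast_add, Nat.cast_one, Nat.add_sub_cancel]
    have h4 : (4 - x ^ 2) * (-(2 * x) / (2 * Real.sqrt (4 - x ^ 2))) =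
        -x * Real.sqrt (4 - x ^ 2) := by
      field_simp
      rw [hq]
    rw [h4]
    ring
  have hi (j : ℕ) : IntervalIntegrable (fun x : ℝ => x ^ j * Real.sqrt (4 - x ^ 2)) volume
      (-2) 2 := (by fun_prop : Continuous _).intervalIntegrable _ _
  have key := intervalIntegral.integral_eq_sub_of_hasDerivAt_of_le (by norm_num : (-2 : ℝ) ≤ 2)
    (by fun_prop) hd
    (((hi k).const_mul _).sub ((hi (k + 2)).const_mul _))
  rw [intervalIntegral.integral_sub ((hi k).const_mul _)
    ((hi (k + 2)).const_mul _), intervalIntegral.integral_const_mul,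
    intervalIntegral.integral_const_mul] at key
  norm_num at key
  linarith

/-- The `k`-th moment of the semicircle distribution. -/
noncomputable def semicircleMoment (k : ℕ) : ℝ := ∫ x, x ^ k ∂semicircle

theorem semicircleMoment_zero : semicircleMoment 0 = 1 := by
  have h : ∫ x in (-2 : ℝ)..2, Real.sqrt (4 - x ^ 2) = 2 * Real.pi := by
    have h1 := intervalIntegral.integral_comp_div (a := -2) (b := 2)
      (fun x : ℝ => 2 * Real.sqrt (1 - x ^ 2)) (two_ne_zero (α := ℝ))
    have h2 : ∀ x : ℝ, 2 * Real.sqrt (1 - (x / 2) ^ 2) = Real.sqrt (4 - x ^ 2) := by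
      intro x
      rw [show 4 - x ^ 2 = 2 ^ 2 * (1 - (x / 2) ^ 2) by ring, Real.sqrt_mul (by norm_num),
        Real.sqrt_sq (by norm_num)]
    simp_rw [h2] at h1
    rw [h1, intervalIntegral.integral_const_mul]
    norm_num [integral_sqrt_one_sub_sq]
    ring
  rw [semicircleMoment, integral_semicircle]
  simp only [pow_zero, one_mul, h]
  field_simp

theorem semicircleMoment_one : semicircleMoment 1 = 0 := by
  rw [semicircleMoment, integral_semicircle]
  have h := intervalIntegral.integral_comp_neg (a := -2) (b := 2)
    (fun x : ℝ => x ^ 1 * Real.sqrt (4 - x ^ 2))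
  simp only [pow_one, neg_sq, neg_mul, neg_neg, intervalIntegral.integral_neg] at h
  have : ∫ x in (-2 : ℝ)..2, x ^ 1 * Real.sqrt (4 - x ^ 2) = 0 := by
    simp only [pow_one]; linarith
  rw [this, mul_zero]

theorem semicircleMoment_step (k : ℕ) :
    (k + 4 : ℝ) * semicircleMoment (k + 2) = 4 * (k + 1) * semicircleMoment k := by
  rw [semicircleMoment, semicircleMoment, integral_semicircle, integral_semicircle]
  linear_combination (1 / (2 * Real.pi)) * integral_pow_mul_sqrt_step k

theorem semicircleMoment_even (m : ℕ) : semicircleMoment (2 * m) = catalan m := by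
  induction m with
  | zero => simp [semicircleMoment_zero]
  | succ m ih =>
    have h := semicircleMoment_step (2 * m)
    rw [ih] at h
    have h1 := succ_mul_catalan_eq_centralBinom m
    have h2 := succ_mul_catalan_eq_centralBinom (m + 1)
    have h3 := Nat.succ_mul_centralBinom_succ m
    rw [← h1, ← h2] at h3
    have h4 : ((m : ℝ) + 1) * ((m + 1 + 1) * catalan (m + 1)) =
        2 * (2 * m + 1) * ((m + 1) * catalan m) := by exact_mod_cast h3
    have hm : (0 : ℝ) < m + 1 := by positivity
    have h5 : ((m : ℝ) + 1 + 1) * catalan (m + 1) = 2 * (2 * m + 1) * catalan m :=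
      mul_left_cancel₀ hm.ne' (by linarith)
    have h6 : ((2 * m : ℕ) + 4 : ℝ) ≠ 0 := by positivity
    refine mul_left_cancel₀ h6 ?_
    rw [show 2 * (m + 1) = 2 * m + 2 by ring, h]
    push_cast
    linarith

theorem semicircleMoment_odd (m : ℕ) : semicircleMoment (2 * m + 1) = 0 := by
  induction m with
  | zero => simpa using semicircleMoment_one
  | succ m ih =>
    have h := semicircleMoment_step (2 * m + 1)
    rw [ih, mul_zero] at h
    have h6 : ((2 * m + 1 : ℕ) + 4 : ℝ) ≠ 0 := by positivity
    exact (mul_eq_zero.1 h).resolve_left h6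

theorem sum_range_even_terms (f : ℕ → ℝ) (hf : ∀ i, f (2 * i + 1) = 0) (m : ℕ) :
    ∑ i ∈ Finset.range (2 * m + 1), f i = ∑ i ∈ Finset.range (m + 1), f (2 * i) := by
  induction m with
  | zero => simp
  | succ m ih =>
    rw [Finset.sum_range_succ _ (m + 1), ← ih, show 2 * (m + 1) + 1 = 2 * m + 1 + 1 + 1 by ring,
      Finset.sum_range_succ, Finset.sum_range_succ, hf]
    simp [mul_add]

/-- The Catalan recursion in the form that cutting a walk at the partner of its first step produces.
Since odd moments vanish, only even indices contribute, and both sides are `0` when `k` is even. -/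
theorem semicircleMoment_succ (k : ℕ) : semicircleMoment (k + 1) =
    ∑ i ∈ Finset.range k, semicircleMoment i * semicircleMoment (k - 1 - i) := by
  rcases Nat.even_or_odd' k with ⟨m, rfl | rfl⟩
  · rw [semicircleMoment_odd, eq_comm]
    refine Finset.sum_eq_zero fun i hi => ?_
    rw [Finset.mem_range] at hi
    rcases Nat.even_or_odd' i with ⟨j, rfl | rfl⟩
    · rw [show 2 * m - 1 - 2 * j = 2 * (m - 1 - j) + 1 by omega, semicircleMoment_odd, mul_zero]
    · rw [semicircleMoment_odd, zero_mul]
  · rw [sum_range_even_terms _ (fun i => by rw [semicircleMoment_odd, zero_mul]),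
      show 2 * m + 1 + 1 = 2 * (m + 1) by ring, semicircleMoment_even, catalan_succ]
    rw [Nat.cast_sum, Finset.sum_range fun i => semicircleMoment (2 * i) * _]
    refine Finset.sum_congr rfl fun i _ => ?_
    rw [show 2 * m + 1 - 1 - 2 * (i : ℕ) = 2 * (m - i) by omega, semicircleMoment_even,
      semicircleMoment_even, Nat.cast_mul]

theorem semicircle_abs_le : ∀ᵐ x ∂semicircle, |x| ≤ 2 := by
  have h : semicircle ≪ volume.restrict (Set.Icc (-2 : ℝ) 2) := withDensity_absolutelyContinuous _ _
  refine h.ae_le ?_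
  filter_upwards [ae_restrict_mem measurableSet_Icc] with x hx
  exact abs_le.2 hx

instance semicircle_isProbabilityMeasure : IsProbabilityMeasure semicircle := by
  have h := semicircleMoment_zero
  simp only [semicircleMoment, pow_zero, integral_const, smul_eq_mul, mul_one] at h
  exact ⟨by simpa [measureReal_def, ENNReal.toReal_eq_one_iff] using h⟩

theorem semicircleMoment_even_le (m : ℕ) : semicircleMoment (2 * m) ≤ 4 ^ m := by
  have h : ∫ x, x ^ (2 * m) ∂semicircle ≤ ∫ _, (4 : ℝ) ^ m ∂semicircle := by
    refine integral_mono_ae (integrable_semicircle (by fun_prop)) (by simp) ?_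
    filter_upwards [semicircle_abs_le] with x hx
    rw [pow_mul]
    exact pow_le_pow_left₀ (sq_nonneg x) (by nlinarith [abs_le.1 hx]) m
  simpa [semicircleMoment] using h

/-! ### Weak convergence from convergence of moments -/

theorem exists_abs_eval_le_mul_pow (q : Polynomial ℝ) :
    ∃ C : ℝ, 0 ≤ C ∧ ∀ x : ℝ, 1 ≤ |x| → |q.eval x| ≤ C * |x| ^ q.natDegree := by
  refine ⟨∑ i ∈ Finset.range (q.natDegree + 1), |q.coeff i|,
    Finset.sum_nonneg fun _ _ => abs_nonneg _, fun x hx => ?_⟩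
  rw [Polynomial.eval_eq_sum_range, Finset.sum_mul]
  refine (Finset.abs_sum_le_sum_abs _ _).trans (Finset.sum_le_sum fun i hi => ?_)
  rw [abs_mul, abs_pow]
  exact mul_le_mul_of_nonneg_left
    (pow_le_pow_right₀ hx (Nat.lt_succ_iff.1 (Finset.mem_range.1 hi))) (abs_nonneg _)

/-- Weierstrass approximation on `[-3, 3]`, strictly larger than the support `[-2, 2]`. Outside it,
any power up to the degree is dominated by `(|x| / 3) ^ (2 * m)`, up to a constant independent of
`m`. The semicircle integral of this tail is at most `(4 / 9) ^ m`, hence small for large `m`. -/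
theorem exists_polynomial_near_with_tail (f : ℝ →ᵇ ℝ) {ε : ℝ} (hε : 0 < ε) :
    ∃ (q : Polynomial ℝ) (C : ℝ) (m₀ : ℕ), 0 ≤ C ∧
      ∀ m, m₀ ≤ m → ∀ x : ℝ, |f x - q.eval x| ≤ ε + C * (1 / 9) ^ m * x ^ (2 * m) := by
  obtain ⟨q, hq⟩ := exists_polynomial_near_of_continuousOn (-3) 3 f f.continuous.continuousOn ε hε
  obtain ⟨C, hC, hCq⟩ := exists_abs_eval_le_mul_pow q
  refine ⟨q, (‖f‖ + C) * 3 ^ q.natDegree, q.natDegree, by positivity, fun m hm x => ?_⟩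
  have hx2 : (0 : ℝ) ≤ x ^ (2 * m) := (even_two_mul m).pow_nonneg x
  rcases le_or_gt |x| 3 with hx | hx
  · have h := hq x (abs_le.1 hx)
    rw [abs_sub_comm]
    have : 0 ≤ (‖f‖ + C) * 3 ^ q.natDegree * (1 / 9) ^ m * x ^ (2 * m) := by positivity
    linarith
  · have h1 : (1 : ℝ) ≤ |x| := by linarith
    have h3 : (1 : ℝ) ≤ |x| / 3 := by rw [le_div_iff₀ (by norm_num)]; linarith
    have h4 : |f x - q.eval x| ≤ (‖f‖ + C) * |x| ^ q.natDegree := by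
      have := hCq x h1
      have hf := f.norm_coe_le_norm x
      rw [Real.norm_eq_abs] at hf
      have h5 : ‖f‖ ≤ ‖f‖ * |x| ^ q.natDegree :=
        le_mul_of_one_le_right (norm_nonneg f) (one_le_pow₀ h1)
      have := abs_sub (f x) (q.eval x)
      nlinarith
    have h5 : |x| ^ q.natDegree ≤ 3 ^ q.natDegree * ((1 / 9) ^ m * x ^ (2 * m)) := by
      have e1 : |x| ^ q.natDegree = 3 ^ q.natDegree * (|x| / 3) ^ q.natDegree := by
        rw [← mul_pow]; congr 1; ring
      have e2 : (1 / 9 : ℝ) ^ m * x ^ (2 * m) = (|x| / 3) ^ (2 * m) := by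
        rw [pow_mul, pow_mul, ← mul_pow, div_pow, sq_abs]; congr 1; ring
      rw [e1, e2]
      exact mul_le_mul_of_nonneg_left (pow_le_pow_right₀ h3 (by omega)) (by positivity)
    have h6 := mul_le_mul_of_nonneg_left h5 (by positivity : 0 ≤ ‖f‖ + C)
    calc _ ≤ (‖f‖ + C) * (3 ^ q.natDegree * ((1 / 9) ^ m * x ^ (2 * m))) := h4.trans h6
      _ ≤ _ := by rw [← mul_assoc, ← mul_assoc]; linarith

theorem integral_polynomial {μ : Measure ℝ} (hint : ∀ k : ℕ, Integrable (fun x : ℝ => x ^ k) μ)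
    (q : Polynomial ℝ) :
    ∫ x, q.eval x ∂μ = ∑ i ∈ Finset.range (q.natDegree + 1), q.coeff i * ∫ x, x ^ i ∂μ := by
  simp_rw [Polynomial.eval_eq_sum_range]
  rw [integral_finsetSum _ fun i _ => (hint i).const_mul _]
  simp_rw [integral_const_mul]

theorem integrable_polynomial {μ : Measure ℝ} (hint : ∀ k : ℕ, Integrable (fun x : ℝ => x ^ k) μ)
    (q : Polynomial ℝ) : Integrable (fun x => q.eval x) μ := by
  simp_rw [Polynomial.eval_eq_sum_range]
  exact integrable_finsetSum _ fun i _ => (hint i).const_mul _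

theorem abs_integral_sub_polynomial_le {μ : Measure ℝ} [IsFiniteMeasure μ]
    (hint : ∀ k : ℕ, Integrable (fun x : ℝ => x ^ k) μ) (f : ℝ →ᵇ ℝ) (q : Polynomial ℝ)
    {ε C : ℝ} {m : ℕ} (h : ∀ x : ℝ, |f x - q.eval x| ≤ ε + C * x ^ (2 * m)) :
    |∫ x, f x ∂μ - ∫ x, q.eval x ∂μ| ≤ ε * ∫ x, x ^ 0 ∂μ + C * ∫ x, x ^ (2 * m) ∂μ := by
  have hf : Integrable f μ := f.integrable μ
  rw [← integral_sub hf (integrable_polynomial hint q), ← integral_const_mul, ← integral_const_mul,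
    ← integral_add ((hint 0).const_mul _) ((hint _).const_mul _)]
  refine (abs_integral_le_integral_abs).trans ?_
  refine integral_mono (hf.sub (integrable_polynomial hint q)).abs
    (((hint 0).const_mul _).add ((hint _).const_mul _)) fun x => ?_
  simpa using h x

theorem tendsto_integral_of_tendsto_moments {μ : ℕ → Measure ℝ} [∀ n, IsFiniteMeasure (μ n)]
    (hint : ∀ n k : ℕ, Integrable (fun x : ℝ => x ^ k) (μ n))
    (h : ∀ k : ℕ, Tendsto (fun n => ∫ x, x ^ k ∂(μ n)) atTop (𝓝 (semicircleMoment k)))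
    (f : ℝ →ᵇ ℝ) :
    Tendsto (fun n => ∫ x, f x ∂(μ n)) atTop (𝓝 (∫ x, f x ∂semicircle)) := by
  have hs (k : ℕ) : Integrable (fun x : ℝ => x ^ k) semicircle :=
    integrable_semicircle (by fun_prop)
  rw [Metric.tendsto_nhds]
  intro δ hδ
  obtain ⟨q, C, m₀, hC, hq⟩ := exists_polynomial_near_with_tail f (by positivity : 0 < δ / 6)
  have hq1 : Tendsto (fun n => ∫ x, q.eval x ∂(μ n)) atTop (𝓝 (∫ x, q.eval x ∂semicircle)) := by
    simp_rw [integral_polynomial (hint _), integral_polynomial hs]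
    exact tendsto_finsetSum _ fun i _ => (h i).const_mul _
  -- The exponent `m` is fixed before `n` grows, so convergence of finitely many moments suffices.
  obtain ⟨m, hm₀, hm⟩ : ∃ m, m₀ ≤ m ∧ C * (4 / 9) ^ m < δ / 6 := by
    have : Tendsto (fun m : ℕ => C * (4 / 9 : ℝ) ^ m) atTop (𝓝 (C * 0)) :=
      (tendsto_pow_atTop_nhds_zero_of_lt_one (by norm_num) (by norm_num)).const_mul C
    rw [mul_zero] at this
    exact ((eventually_ge_atTop m₀).and (this.eventually (gt_mem_nhds (by positivity)))).exists
  have hlim : Tendsto (fun n => δ / 6 * ∫ x, x ^ 0 ∂(μ n) +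
      C * (1 / 9) ^ m * ∫ x, x ^ (2 * m) ∂(μ n)) atTop
      (𝓝 (δ / 6 * semicircleMoment 0 + C * (1 / 9) ^ m * semicircleMoment (2 * m))) :=
    ((h 0).const_mul _).add ((h (2 * m)).const_mul _)
  have hlt : δ / 6 * semicircleMoment 0 + C * (1 / 9) ^ m * semicircleMoment (2 * m) < δ / 3 := by
    have h1 := mul_le_mul_of_nonneg_left (semicircleMoment_even_le m)
      (by positivity : 0 ≤ C * (1 / 9) ^ m)
    rw [mul_assoc C _ (4 ^ m), ← mul_pow] at h1
    rw [semicircleMoment_zero]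
    norm_num at h1 hm ⊢
    linarith
  have e1 := hlim.eventually (gt_mem_nhds hlt)
  have e2 := (Metric.tendsto_nhds.1 hq1) (δ / 3) (by positivity)
  have e3 := abs_integral_sub_polynomial_le hs f q (hq m hm₀)
  filter_upwards [e1, e2] with n h1 h2
  have h3 := abs_integral_sub_polynomial_le (hint n) f q (hq m hm₀)
  change _ ≤ δ / 6 * semicircleMoment 0 + C * (1 / 9) ^ m * semicircleMoment (2 * m) at e3
  rw [Real.dist_eq] at h2 ⊢
  rw [abs_le] at h3 e3
  rw [abs_lt] at h2 ⊢
  constructor <;> linarith [h3.1, h3.2, e3.1, e3.2, h2.1, h2.2]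

section Measurability

variable {Ω : Type*}

theorem esdConvergesAt_of_tendsto_moments {a : ℕ → ℕ → Ω → ℝ} {ω : Ω}
    (h : ∀ k : ℕ, Tendsto (fun n => ∫ x, x ^ k ∂(esd a n ω)) atTop (𝓝 (semicircleMoment k))) :
    ESDConvergesAt a ω := by
  rw [ESDConvergesAt, FiniteMeasure.tendsto_iff_forall_integral_tendsto]
  exact fun f => tendsto_integral_of_tendsto_moments (fun n k => integrable_esd a n ω _) h f

theorem ESDConvergesAt.tendsto_integral {a : ℕ → ℕ → Ω → ℝ} {ω : Ω} (h : ESDConvergesAt a ω)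
    (f : ℝ →ᵇ ℝ) :
    Tendsto (fun n => ∫ x, f x ∂(esd a n ω)) atTop (𝓝 (∫ x, f x ∂semicircle)) :=
  FiniteMeasure.tendsto_iff_forall_integral_tendsto.1 h f

/-! ### Measurability of spectral statistics -/

variable [MeasurableSpace Ω]

theorem measurable_tracePow {a : ℕ → ℕ → Ω → ℝ} (ha : ∀ p q, p ≤ q → Measurable (a p q))
    (n K : ℕ) : Measurable (tracePow a n K) := by
  unfold tracePow walkWeight entry
  exact Finset.measurable_fun_sum _ fun p _ => Finset.measurable_fun_prod _ fun i _ =>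
    ha _ _ min_le_max

/-- Measurability of single eigenvalues is bypassed: integrals of polynomials are polynomials in the
matrix entries, and the integral of `f` is a pointwise limit of these. -/
theorem measurable_integral_esd {a : ℕ → ℕ → Ω → ℝ} (ha : ∀ p q, p ≤ q → Measurable (a p q))
    (n : ℕ) {f : ℝ → ℝ} (hf : Continuous f) : Measurable fun ω => ∫ x, f x ∂(esd a n ω) := by
  -- The `k`-th polynomial is `1 / (k + 1)`-close to `f` on `[-k, k]`, an interval that eventually
  -- contains every eigenvalue at a fixed `ω`.
  have hq (k : ℕ) := exists_polynomial_near_of_continuousOn (-k) k f hf.continuousOn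
    (1 / ((k : ℝ) + 1)) (by positivity)
  choose q hq using hq
  refine measurable_of_tendsto_metrizable (f := fun k ω => ∫ x, (q k).eval x ∂(esd a n ω))
    (fun k => ?_) ?_
  · simp_rw [fun ω => integral_polynomial (fun j => integrable_esd a n ω fun x => x ^ j) (q k),
      integral_pow_esd_eq]
    exact Finset.measurable_fun_sum _ fun i _ =>
      ((measurable_tracePow ha n i).div_const _).const_mul _
  · rw [tendsto_pi_nhds]
    intro ω
    simp_rw [integral_esd]
    refine Tendsto.const_mul _ (tendsto_finsetSum _ fun i _ => ?_)
    set t := (X_isHermitian a n ω).eigenvalues i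
    refine tendsto_iff_dist_tendsto_zero.2 ?_
    refine squeeze_zero' (Eventually.of_forall fun _ => dist_nonneg) ?_
      tendsto_one_div_add_atTop_nhds_zero_nat
    filter_upwards [eventually_ge_atTop ⌈|t|⌉₊] with k hk
    have : |t| ≤ k := (Nat.le_ceil _).trans (by exact_mod_cast hk)
    exact (hq k t (abs_le.1 this)).le

end Measurability

/-! ### Counting walks by the number of distinct step lengths -/

section Counting

variable {ι : Type*} [Fintype ι]

/-- The number of distinct values of a function on a finite type. -/
def numValues (r : ι → ℕ) : ℕ := (Finset.univ.image r).card

/-- Every value is attained at least twice. -/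
def NoSingleton (r : ι → ℕ) : Prop := ∀ i, ∃ j, j ≠ i ∧ r j = r i

theorem two_le_card_fiber [DecidableEq ι] {r : ι → ℕ} (h : NoSingleton r) {v : ℕ}
    (hv : v ∈ Finset.univ.image r) : 2 ≤ (Finset.univ.filter fun i => r i = v).card := by
  obtain ⟨i, -, rfl⟩ := Finset.mem_image.1 hv
  obtain ⟨j, hj, hr⟩ := h i
  exact Nat.succ_le_of_lt (Finset.one_lt_card.2 ⟨j, by simp [hr], i, by simp, hj⟩)

theorem NoSingleton.two_mul_numValues_le [DecidableEq ι] {r : ι → ℕ} (h : NoSingleton r) :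
    2 * numValues r ≤ Fintype.card ι := by
  rw [← Finset.card_univ, Finset.card_eq_sum_card_image r, numValues, mul_comm, ← smul_eq_mul,
    ← Finset.sum_const]
  exact Finset.sum_le_sum fun v hv => two_le_card_fiber h hv

/-- If the number of values is half the number of indices then every value is attained exactly
twice. -/
theorem NoSingleton.eq_of_eq [DecidableEq ι] {r : ι → ℕ} (h : NoSingleton r)
    (hc : Fintype.card ι ≤ 2 * numValues r) {i j k : ι} (hj : r j = r i) (hk : r k = r i)
    (hji : j ≠ i) (hki : k ≠ i) : j = k := by
  by_contra hjk
  have hlt : ∑ _v ∈ Finset.univ.image r, 2 <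
      ∑ v ∈ Finset.univ.image r, (Finset.univ.filter fun i => r i = v).card := by
    refine Finset.sum_lt_sum (fun v hv => two_le_card_fiber h hv)
      ⟨r i, Finset.mem_image_of_mem _ (Finset.mem_univ _), ?_⟩
    rw [Finset.two_lt_card]
    exact ⟨i, by simp, j, by simp [hj], k, by simp [hk], hji.symm, hki.symm, hjk⟩
  rw [← Finset.card_eq_sum_card_image, Finset.sum_const, smul_eq_mul, Finset.card_univ] at hlt
  rw [numValues] at hc
  omega

theorem exists_cover_of_card_le {n j : ℕ} (hn : 0 < n) {V : Finset ℕ} (hV : V.card ≤ j)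
    (hlt : ∀ v ∈ V, v < n) : ∃ c : Fin j → Fin n, ∀ v ∈ V, ∃ l, (c l : ℕ) = v := by
  have : Nonempty (Fin n) := ⟨⟨0, hn⟩⟩
  obtain ⟨e⟩ : Nonempty (V ↪ Fin j) :=
    Function.Embedding.nonempty_of_card_le (by simpa using hV)
  refine ⟨Function.extend e (fun v => ⟨v, hlt v v.2⟩) fun _ => ⟨0, hn⟩, fun v hv => ⟨e ⟨v, hv⟩, ?_⟩⟩
  rw [e.injective.extend_apply]

theorem exists_sign_mul_natAbs {κ : Type*} (d : κ → ℤ) :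
    ∃ s : κ → Bool, ∀ i, d i = (if s i then 1 else -1) * ((d i).natAbs : ℤ) := by
  refine ⟨fun i => decide (0 ≤ d i), fun i => ?_⟩
  by_cases h : 0 ≤ d i
  · simp [h, abs_of_nonneg h]
  · simp [h, abs_of_neg (not_le.1 h)]

/-- The number of integer vectors with entries less than `n` and at most `j` absolute values. -/
theorem card_le_of_numValues_le [DecidableEq ι] {n j : ℕ} (hn : 0 < n) (S : Finset (ι → ℤ))
    (hlt : ∀ d ∈ S, ∀ i, (d i).natAbs < n)
    (hj : ∀ d ∈ S, numValues (fun i => (d i).natAbs) ≤ j) :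
    S.card ≤ (j ^ Fintype.card ι * 2 ^ Fintype.card ι) * n ^ j := by
  -- A vector is encoded by a label and a sign for each index, and by the `j` absolute values that
  -- the labels refer to. Only the last item depends on `n`.
  let F : (ι → Fin j) × (ι → Bool) × (Fin j → Fin n) → (ι → ℤ) :=
    fun x i => (if x.2.1 i then 1 else -1) * ((x.2.2 (x.1 i) : ℕ) : ℤ)
  have hsub : S ⊆ Finset.univ.image F := by
    intro d hd
    obtain ⟨c, hc⟩ := exists_cover_of_card_le hn (hj d hd) (by simpa using hlt d hd)
    have hc' (i : ι) : ∃ l, (c l : ℕ) = (d i).natAbs :=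
      hc _ (Finset.mem_image_of_mem _ (Finset.mem_univ i))
    choose lab hlab using hc'
    obtain ⟨s, hs⟩ := exists_sign_mul_natAbs d
    refine Finset.mem_image.2 ⟨(lab, s, c), Finset.mem_univ _, ?_⟩
    funext i
    simp only [F, hlab]
    exact (hs i).symm
  refine (Finset.card_le_card hsub).trans (Finset.card_image_le.trans ?_)
  simp [Finset.card_univ, mul_assoc]

/-- The number of integer vectors with entries less than `n` and at most `j + 1` absolute values
that solve a linear equation in which the coefficient of one of these values does not vanish. -/
theorem card_le_of_linear_constraint [DecidableEq ι] {n j : ℕ} (hn : 0 < n) (w : ι → ℤ) (b : ℤ)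
    (S : Finset (ι → ℤ)) (hlt : ∀ d ∈ S, ∀ i, (d i).natAbs < n)
    (hj : ∀ d ∈ S, numValues (fun i => (d i).natAbs) ≤ j + 1)
    (hb : ∀ d ∈ S, ∑ i, w i * d i = b)
    (hne : ∀ d ∈ S, ∃ i₀, d i₀ = 0 ∨
      ∑ i with (d i).natAbs = (d i₀).natAbs, w i * d i ≠ 0) :
    S.card ≤ ((j + 1) ^ Fintype.card ι * 2 ^ Fintype.card ι * 2) * n ^ j := by
  let sg : Bool → ℤ := fun t => if t then 1 else -1
  -- The indices in the class of `i₀` carry the label `none`, and their common absolute value `y` is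
  -- not stored: it is recovered by exact division from the linear equation. The last Boolean
  -- records `d i₀ = 0`, where the coefficient of `y` may vanish.
  let F : (ι → Option (Fin j)) × (ι → Bool) × (Fin j → Fin n) × Bool → (ι → ℤ) := fun x =>
    let val : ι → ℤ := fun i => (x.1 i).elim 0 fun l => ((x.2.2.1 l : ℕ) : ℤ)
    let y : ℤ := if x.2.2.2 then 0 else
      (b - ∑ i, w i * (sg (x.2.1 i) * val i)) / ∑ i with x.1 i = none, w i * sg (x.2.1 i)
    fun i => sg (x.2.1 i) * (if x.1 i = none then y else val i)
  have hsub : S ⊆ Finset.univ.image F := by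
    intro d hd
    obtain ⟨i₀, hi₀⟩ := hne d hd
    obtain ⟨c, hc⟩ := exists_cover_of_card_le (j := j) hn
      (V := (Finset.univ.image fun i => (d i).natAbs).erase (d i₀).natAbs)
      (by
        rw [Finset.card_erase_of_mem (Finset.mem_image_of_mem _ (Finset.mem_univ i₀))]
        have := hj d hd
        rw [numValues] at this
        omega)
      (fun v hv => by
        obtain ⟨i, -, rfl⟩ := Finset.mem_image.1 (Finset.mem_of_mem_erase hv)
        exact hlt d hd i)
    have hc' (i : ι) : ∃ o : Option (Fin j), (o = none ↔ (d i).natAbs = (d i₀).natAbs) ∧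
        ∀ l, o = some l → (c l : ℕ) = (d i).natAbs := by
      by_cases h : (d i).natAbs = (d i₀).natAbs
      · exact ⟨none, by simp [h], by simp⟩
      · obtain ⟨l, hl⟩ := hc _ (Finset.mem_erase.2
          ⟨h, Finset.mem_image_of_mem (fun i => (d i).natAbs) (Finset.mem_univ i)⟩)
        exact ⟨some l, by simp [h], by simpa using hl⟩
    choose lab hlab hlabc using hc'
    obtain ⟨s, hs⟩ := exists_sign_mul_natAbs d
    have hs' (i : ι) : d i = sg (s i) * ((d i).natAbs : ℤ) := hs i
    have hval (i : ι) : ((lab i).elim 0 fun l => ((c l : ℕ) : ℤ)) =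
        if lab i = none then 0 else ((d i).natAbs : ℤ) := by
      cases h : lab i with
      | none => simp
      | some l => simp [hlabc i l h]
    refine Finset.mem_image.2 ⟨(lab, s, c, decide (d i₀ = 0)), Finset.mem_univ _, ?_⟩
    have hy : (if d i₀ = 0 then 0 else
        (b - ∑ i, w i * (sg (s i) * (lab i).elim 0 fun l => ((c l : ℕ) : ℤ))) /
          ∑ i with lab i = none, w i * sg (s i)) = ((d i₀).natAbs : ℤ) := by
      by_cases h0 : d i₀ = 0
      · simp [h0]
      · rw [if_neg h0]
        have hne' := hi₀.resolve_left h0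
        have hsum : ∑ i with (d i).natAbs = (d i₀).natAbs, w i * d i =
            (∑ i with lab i = none, w i * sg (s i)) * ((d i₀).natAbs : ℤ) := by
          rw [Finset.sum_mul]
          refine Finset.sum_congr (by ext i; simp [hlab]) fun i hi => ?_
          rw [hs' i, (hlab i).1 (by simpa using hi)]
          ring
        have hm : ∑ i with lab i = none, w i * sg (s i) ≠ 0 := by
          intro h
          rw [hsum, h, zero_mul] at hne'
          exact hne' rfl
        have hrest : ∑ i, w i * (sg (s i) * (lab i).elim 0 fun l => ((c l : ℕ) : ℤ)) =
            b - ∑ i with (d i).natAbs = (d i₀).natAbs, w i * d i := by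
          rw [← hb d hd, ← Finset.sum_filter_add_sum_filter_not Finset.univ
            (fun i => (d i).natAbs = (d i₀).natAbs) (fun i => w i * d i), add_sub_cancel_left,
            Finset.sum_filter]
          refine Finset.sum_congr rfl fun i _ => ?_
          rw [hval]
          by_cases h : (d i).natAbs = (d i₀).natAbs
          · simp [(hlab i).2 h, h]
          · have h' : lab i ≠ none := fun e => h ((hlab i).1 e)
            simp only [h', h, if_false, not_false_eq_true, if_true]
            rw [← hs' i]
        rw [hrest, sub_sub_cancel, hsum, Int.mul_ediv_cancel_left _ hm]
    funext i
    simp only [F, decide_eq_true_eq]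
    rw [hy, hval]
    by_cases h : lab i = none
    · rw [if_pos h, ← (hlab i).1 h]
      exact (hs' i).symm
    · rw [if_neg h, if_neg h]
      exact (hs' i).symm
  refine (Finset.card_le_card hsub).trans (Finset.card_image_le.trans ?_)
  simp only [Finset.card_univ, Fintype.card_prod, Fintype.card_pi, Finset.prod_const,
    Fintype.card_option, Fintype.card_fin, Fintype.card_bool]
  apply le_of_eq
  ring

/-- A linear form with a non-zero value has a value of the absolute values with non-vanishing
contribution. -/
theorem exists_class_sum_ne_zero {w d : ι → ℤ} {b : ℤ} (hb : ∑ i, w i * d i = b) (hb0 : b ≠ 0) :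
    ∃ i₀, ∑ i with (d i).natAbs = (d i₀).natAbs, w i * d i ≠ 0 := by
  by_contra! h
  apply hb0
  rw [← hb, ← Finset.sum_fiberwise_of_maps_to (g := fun i => (d i).natAbs)
    (t := Finset.univ.image fun i => (d i).natAbs)
    fun i _ => Finset.mem_image_of_mem _ (Finset.mem_univ i)]
  refine Finset.sum_eq_zero fun v hv => ?_
  obtain ⟨i, -, rfl⟩ := Finset.mem_image.1 hv
  exact h i

end Counting

/-! ### Steps of a walk -/

/-- The steps of a walk. -/
def walkStep {n K : ℕ} (p : Fin (K + 1) → Fin n) (i : Fin K) : ℤ :=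
  ((p i.succ : ℕ) : ℤ) - ((p i.castSucc : ℕ) : ℤ)

theorem walkStep_natAbs_lt {n K : ℕ} (p : Fin (K + 1) → Fin n) (i : Fin K) :
    (walkStep p i).natAbs < n := by
  have h1 := (p i.succ).2
  have h2 := (p i.castSucc).2
  rw [walkStep]
  omega

theorem walk_ext {n K : ℕ} {p q : Fin (K + 1) → Fin n} (h0 : p 0 = q 0)
    (h : walkStep p = walkStep q) : p = q := by
  funext i
  induction i using Fin.induction with
  | zero => exact h0
  | succ i ih =>
    have := congrFun h i
    rw [walkStep, walkStep, ih] at this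
    exact Fin.ext (by omega)

/-- Displacements become linear forms in the steps, so prescribing one is a constraint of the kind
counted in `card_le_of_linear_constraint`. -/
theorem sum_walkStep_of_lt {n K : ℕ} (p : Fin (K + 1) → Fin n) (j : Fin K) :
    ∑ i, (if i ≤ j then 1 else 0) * walkStep p i = ((p j.succ : ℕ) : ℤ) - ((p 0 : ℕ) : ℤ) := by
  induction K with
  | zero => exact j.elim0
  | succ K ih =>
    rw [Fin.sum_univ_castSucc]
    refine Fin.lastCases ?_ (fun j => ?_) j
    · simp only [Fin.le_last, if_true, one_mul]
      cases K with
      | zero => simp [walkStep]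
      | succ K =>
        have := ih (fun i => p i.castSucc) (Fin.last K)
        simp only [Fin.le_last, if_true, one_mul] at this
        have e : ∑ i : Fin (K + 1), walkStep p i.castSucc =
            ∑ i, walkStep (fun i => p i.castSucc) i :=
          Finset.sum_congr rfl fun i _ => by simp [walkStep]
        rw [e, this]
        simp [walkStep]
    · have := ih (fun i => p i.castSucc) j
      have hj : ¬ Fin.last K ≤ j.castSucc := by simp
      rw [if_neg hj, zero_mul, add_zero, Fin.succ_castSucc]
      rw [Fin.castSucc_zero] at this
      rw [← this]
      exact Finset.sum_congr rfl fun i _ => by simp [walkStep]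

theorem sum_walkStep {n K : ℕ} (p : Fin (K + 1) → Fin n) :
    ∑ i, walkStep p i = ((p (Fin.last K) : ℕ) : ℤ) - ((p 0 : ℕ) : ℤ) := by
  cases K with
  | zero => simp
  | succ K => simpa [Fin.le_last] using sum_walkStep_of_lt p (Fin.last K)

theorem sum_walkStep_of_mem {n K : ℕ} {p : Fin (K + 1) → Fin n} (hp : p ∈ closedWalks n K) :
    ∑ i, walkStep p i = 0 := by
  rw [sum_walkStep, ← (Finset.mem_filter.1 hp).2, sub_self]

/-- The step lengths of a walk. -/
def stepLength {n K : ℕ} (p : Fin (K + 1) → Fin n) (i : Fin K) : ℕ := (walkStep p i).natAbs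

/-- A walk is determined by its starting point and its signed steps. -/
theorem card_walks_le {n K : ℕ} (W : Finset (Fin (K + 1) → Fin n)) :
    W.card ≤ n * (W.image walkStep).card := by
  have h : W.card ≤ ((Finset.univ : Finset (Fin n)) ×ˢ W.image walkStep).card := by
    refine Finset.card_le_card_of_injOn (fun p => (p 0, walkStep p)) (fun p hp => ?_) ?_
    · simpa using ⟨p, hp, rfl⟩
    · intro p _ q _ hpq
      exact walk_ext (congrArg Prod.fst hpq) (congrArg Prod.snd hpq)
  simpa using h

theorem card_walk_pairs_le {n K L : ℕ}
    (W : Finset ((Fin (K + 1) → Fin n) × (Fin (L + 1) → Fin n))) :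
    W.card ≤ n ^ 2 * (W.image fun p => Sum.elim (walkStep p.1) (walkStep p.2)).card := by
  have h : W.card ≤ ((Finset.univ : Finset (Fin n × Fin n)) ×ˢ
      W.image fun p => Sum.elim (walkStep p.1) (walkStep p.2)).card := by
    refine Finset.card_le_card_of_injOn
      (fun p => ((p.1 0, p.2 0), Sum.elim (walkStep p.1) (walkStep p.2))) (fun p hp => ?_) ?_
    · rw [Finset.mem_coe, Finset.mem_product]
      exact ⟨Finset.mem_univ _, Finset.mem_image_of_mem _ hp⟩
    · intro p _ q _ hpq
      have h1 := congrArg Prod.fst hpq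
      have h2 := congrArg Prod.snd hpq
      simp only [Prod.mk.injEq] at h1
      refine Prod.ext (walk_ext h1.1 ?_) (walk_ext h1.2 ?_)
      · funext i; exact congrFun h2 (Sum.inl i)
      · funext i; exact congrFun h2 (Sum.inr i)
  simpa [pow_two] using h

/-! ### Expectations of products of entries -/

section Products

variable {Ω : Type*}

/-- The diagonal visited by a step is indexed by the length of the step, so independence of
diagonals becomes independence across step lengths. -/
theorem entry_eq_diagonal (a : ℕ → ℕ → Ω → ℝ) (x y : ℕ) (ω : Ω) :
    entry a x y ω = diagonal a ((y : ℤ) - x).natAbs ω (min x y) := by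
  rw [entry, diagonal]
  congr 1
  omega

theorem entry_comm (a : ℕ → ℕ → Ω → ℝ) (x y : ℕ) : entry a x y = entry a y x := by
  funext ω
  rw [entry, entry, min_comm, max_comm]

/-- The product is at most a power of its largest factor; the summand `1` serves the empty product.
This reduces all integrability to moments of single entries. -/
theorem abs_prod_le_one_add_sum_pow {ι : Type*} (S : Finset ι) (f : ι → ℝ) :
    |∏ i ∈ S, f i| ≤ 1 + ∑ i ∈ S, |f i| ^ S.card := by
  rcases S.eq_empty_or_nonempty with rfl | hS
  · simp
  · obtain ⟨i, hi, hmax⟩ := S.exists_max_image (fun i => |f i|) hS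
    rw [Finset.abs_prod]
    calc ∏ j ∈ S, |f j| ≤ ∏ _j ∈ S, |f i| := Finset.prod_le_prod (fun _ _ => abs_nonneg _) hmax
      _ = |f i| ^ S.card := Finset.prod_const _
      _ ≤ ∑ j ∈ S, |f j| ^ S.card :=
        Finset.single_le_sum (f := fun j => |f j| ^ S.card) (fun _ _ => by positivity) hi
      _ ≤ _ := by linarith

variable [MeasurableSpace Ω] {P : Measure Ω} {a : ℕ → ℕ → Ω → ℝ}

namespace IsDiagonalArray

theorem measurable_entry (ha : IsDiagonalArray P a) (x y : ℕ) : Measurable (entry a x y) :=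
  ha.measurable _ _ min_le_max

theorem measurable_diagonal (ha : IsDiagonalArray P a) (r : ℕ) : Measurable (diagonal a r) :=
  measurable_pi_lambda _ fun _ => ha.measurable _ _ (Nat.le_add_right _ _)

theorem integrable_abs_entry_pow (ha : IsDiagonalArray P a) (x y k : ℕ) :
    Integrable (fun ω => |entry a x y ω| ^ k) P := by
  obtain ⟨C, hC⟩ := ha.moments k
  exact (hC _ _ min_le_max).1

theorem integral_entry (ha : IsDiagonalArray P a) (x y : ℕ) : ∫ ω, entry a x y ω ∂P = 0 :=
  ha.mean_zero _ _ min_le_max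

theorem integral_entry_sq (ha : IsDiagonalArray P a) (x y : ℕ) :
    ∫ ω, entry a x y ω ^ 2 ∂P = 1 :=
  ha.unit_variance _ _ min_le_max

theorem integral_diagonal_mul_diagonal (ha : IsDiagonalArray P a) (r s t : ℕ) :
    ∫ ω, diagonal a r ω s * diagonal a r ω (s + t) ∂P = corr P a r t := by
  have hm := ha.measurable_diagonal r
  have hg (u v : ℕ) : AEStronglyMeasurable (fun z : ℕ → ℝ => z u * z v) (diagonalLaw P a r) := by
    exact (by fun_prop : Measurable _).aestronglyMeasurable
  have hiter (z : ℕ → ℝ) (u : ℕ) : shift^[s] z u = z (u + s) := by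
    clear hg
    induction s generalizing z with
    | zero => simp
    | succ s ih => rw [Function.iterate_succ_apply, ih, shift, add_assoc]
  have h1 : ∫ ω, diagonal a r ω s * diagonal a r ω (s + t) ∂P =
      ∫ z, z s * z (s + t) ∂(diagonalLaw P a r) := by
    rw [diagonalLaw, integral_map hm.aemeasurable (hg _ _)]
  have h2 : corr P a r t = ∫ z, z 0 * z t ∂(diagonalLaw P a r) := by
    rw [diagonalLaw, integral_map hm.aemeasurable (hg _ _)]
    simp [corr, diagonal]
  have hmp := (ha.stationary r).iterate s
  rw [h1, h2]
  conv_rhs => rw [← hmp.map_eq]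
  rw [integral_map hmp.measurable.aemeasurable (by rw [hmp.map_eq]; exact hg _ _)]
  simp [hiter, add_comm]

theorem integral_entry_mul_entry (ha : IsDiagonalArray P a) {x y x' y' : ℕ}
    (h : ((y : ℤ) - x).natAbs = ((y' : ℤ) - x').natAbs) :
    ∫ ω, entry a x y ω * entry a x' y' ω ∂P =
      corr P a ((y : ℤ) - x).natAbs ((min x y : ℤ) - min x' y').natAbs := by
  simp_rw [entry_eq_diagonal, ← h]
  rcases le_total (min x y) (min x' y') with hle | hle
  · have := ha.integral_diagonal_mul_diagonal ((y : ℤ) - x).natAbs (min x y)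
      (min x' y' - min x y)
    rw [Nat.add_sub_cancel' hle] at this
    rw [this]
    congr 1
    omega
  · have := ha.integral_diagonal_mul_diagonal ((y : ℤ) - x).natAbs (min x' y')
      (min x y - min x' y')
    rw [Nat.add_sub_cancel' hle] at this
    simp_rw [mul_comm (diagonal a _ _ (min x y))]
    rw [this]
    congr 1
    omega

variable [IsProbabilityMeasure P]

theorem integrable_prod (ha : IsDiagonalArray P a) {ι : Type*} (S : Finset ι) (x y : ι → ℕ) :
    Integrable (fun ω => ∏ i ∈ S, entry a (x i) (y i) ω) P := by
  refine Integrable.mono' (g := fun ω => 1 + ∑ i ∈ S, |entry a (x i) (y i) ω| ^ S.card) ?_ ?_ ?_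
  · exact (integrable_const _).add
      (integrable_finsetSum _ fun i _ => ha.integrable_abs_entry_pow _ _ _)
  · exact (Finset.measurable_fun_prod _ fun i _ =>
      ha.measurable_entry _ _).aestronglyMeasurable
  · exact ae_of_all _ fun ω => abs_prod_le_one_add_sum_pow S _

theorem exists_abs_integral_prod_le (ha : IsDiagonalArray P a) (m : ℕ) :
    ∃ C : ℝ, 0 ≤ C ∧ ∀ (ι : Type) (S : Finset ι) (x y : ι → ℕ), S.card ≤ m →
      |∫ ω, ∏ i ∈ S, entry a (x i) (y i) ω ∂P| ≤ C := by
  choose D hD using ha.moments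
  have hD0 (k : ℕ) : 0 ≤ D k :=
    (integral_nonneg fun ω => by positivity).trans (hD k 0 0 le_rfl).2
  -- Summing the bounds for all cardinalities up to `m` gives one constant, free of the index type
  -- and of the positions of the entries.
  refine ⟨∑ k ∈ Finset.range (m + 1), (1 + k * D k), Finset.sum_nonneg fun k _ => by
    have := hD0 k; positivity, fun ι S x y hS => ?_⟩
  have h1 : |∫ ω, ∏ i ∈ S, entry a (x i) (y i) ω ∂P| ≤ 1 + S.card * D S.card := by
    refine abs_integral_le_integral_abs.trans ?_
    refine (integral_mono (ha.integrable_prod S x y).abs ((integrable_const 1).add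
      (integrable_finsetSum S fun i _ => ha.integrable_abs_entry_pow (x i) (y i) S.card))
      fun ω => abs_prod_le_one_add_sum_pow S _).trans ?_
    rw [integral_add' (integrable_const 1)
      (integrable_finsetSum S fun i _ => ha.integrable_abs_entry_pow (x i) (y i) S.card),
      integral_finsetSum S fun i _ => ha.integrable_abs_entry_pow (x i) (y i) S.card]
    simp only [integral_const, probReal_univ, smul_eq_mul, mul_one, add_le_add_iff_left]
    refine (Finset.sum_le_sum fun i _ => (hD S.card _ _ min_le_max).2).trans ?_
    simp
  exact h1.trans (Finset.single_le_sum (f := fun k : ℕ => 1 + k * D k)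
    (fun k _ => by have := hD0 k; positivity) (Finset.mem_range.2 (Nat.lt_succ_of_le hS)))

/-- Products of entries over disjoint sets of diagonals are uncorrelated. -/
theorem integral_prod_mul_prod (ha : IsDiagonalArray P a) {ι : Type*} (S T : Finset ι)
    (x y : ι → ℕ)
    (hST : ∀ i ∈ S, ∀ j ∈ T, ((y i : ℤ) - x i).natAbs ≠ ((y j : ℤ) - x j).natAbs) :
    ∫ ω, (∏ i ∈ S, entry a (x i) (y i) ω) * ∏ i ∈ T, entry a (x i) (y i) ω ∂P =
      (∫ ω, ∏ i ∈ S, entry a (x i) (y i) ω ∂P) * ∫ ω, ∏ i ∈ T, entry a (x i) (y i) ω ∂P := by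
  classical
  set r : ι → ℕ := fun i => ((y i : ℤ) - x i).natAbs with hr
  have hdisj : Disjoint (S.image r) (T.image r) := by
    rw [Finset.disjoint_left]
    intro v hv hv'
    obtain ⟨i, hi, rfl⟩ := Finset.mem_image.1 hv
    obtain ⟨j, hj, h⟩ := Finset.mem_image.1 hv'
    exact hST i hi j hj h.symm
  have hind := ha.indep.indepFun_finset _ _ hdisj ha.measurable_diagonal
  let φ : (U : Finset ι) → ((v : U.image r) → (ℕ → ℝ)) → ℝ := fun U z =>
    ∏ i : U, z ⟨r i, Finset.mem_image_of_mem r i.2⟩ (min (x i) (y i))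
  have hφ (U : Finset ι) : Measurable (φ U) :=
    Finset.measurable_fun_prod _ fun i _ => by fun_prop
  have hcomp (U : Finset ι) : (fun ω => ∏ i ∈ U, entry a (x i) (y i) ω) =
      φ U ∘ fun ω (v : U.image r) => diagonal a v ω := by
    funext ω
    simp only [φ, Function.comp_apply]
    rw [← Finset.prod_coe_sort]
    exact Finset.prod_congr rfl fun i _ => entry_eq_diagonal a _ _ ω
  have h := hind.comp (hφ S) (hφ T)
  rw [← hcomp, ← hcomp] at h
  exact h.integral_fun_mul_eq_mul_integral (ha.integrable_prod S x y).aestronglyMeasurable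
    (ha.integrable_prod T x y).aestronglyMeasurable

/-- A factor alone on its diagonal is independent of the others, and it is centred. -/
theorem integral_prod_eq_zero (ha : IsDiagonalArray P a) {ι : Type*} [DecidableEq ι]
    (S : Finset ι) (x y : ι → ℕ) {i : ι} (hi : i ∈ S)
    (h : ∀ j ∈ S, j ≠ i → ((y j : ℤ) - x j).natAbs ≠ ((y i : ℤ) - x i).natAbs) :
    ∫ ω, ∏ i ∈ S, entry a (x i) (y i) ω ∂P = 0 := by
  have h1 := ha.integral_prod_mul_prod {i} (S.erase i) x y (by
    intro k hk j hj
    rw [Finset.mem_singleton.1 hk]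
    exact (h j (Finset.mem_of_mem_erase hj) (Finset.ne_of_mem_erase hj)).symm)
  simp only [Finset.prod_singleton, ha.integral_entry, zero_mul] at h1
  rw [← h1]
  congr 1
  funext ω
  rw [Finset.mul_prod_erase S (fun i => entry a (x i) (y i) ω) hi]

end IsDiagonalArray

end Products

/-! ### Bounds on the number of walks -/

theorem pow_le_sqrt_pow {n j M : ℕ} (hn : 0 < n) (h : 2 * j ≤ M) :
    ((n ^ j : ℕ) : ℝ) ≤ Real.sqrt n ^ M := by
  have h1 : (1 : ℝ) ≤ Real.sqrt n := by
    rw [Real.one_le_sqrt]; exact_mod_cast hn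
  calc ((n ^ j : ℕ) : ℝ) = Real.sqrt n ^ (2 * j) := by
        rw [pow_mul, Real.sq_sqrt (Nat.cast_nonneg n)]; push_cast; rfl
    _ ≤ _ := pow_le_pow_right₀ h1 h

/-- At most `M / 2` lengths and the starting point are free. -/
theorem exists_card_walks_le (K M : ℕ) : ∃ C : ℝ, 0 ≤ C ∧ ∀ n, 0 < n →
    ∀ W : Finset (Fin (K + 1) → Fin n), (∀ p ∈ W, 2 * numValues (stepLength p) ≤ M) →
      (W.card : ℝ) ≤ C * Real.sqrt n ^ (M + 2) := by
  refine ⟨(((M / 2) ^ K * 2 ^ K : ℕ) : ℝ), by positivity, fun n hn W hW => ?_⟩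
  have h := card_le_of_numValues_le (j := M / 2) hn (W.image walkStep)
    (by simpa using fun p _ => walkStep_natAbs_lt p)
    (by
      intro d hd
      obtain ⟨p, hp, rfl⟩ := Finset.mem_image.1 hd
      have := hW p hp
      change numValues (stepLength p) ≤ _
      omega)
  rw [Fintype.card_fin] at h
  have h2 : W.card ≤ ((M / 2) ^ K * 2 ^ K) * n ^ (M / 2 + 1) :=
    (card_walks_le W).trans ((Nat.mul_le_mul_left n h).trans (le_of_eq (by ring)))
  calc (W.card : ℝ) ≤ (((M / 2) ^ K * 2 ^ K : ℕ) : ℝ) * ((n ^ (M / 2 + 1) : ℕ) : ℝ) := by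
        exact_mod_cast h2
    _ ≤ _ := mul_le_mul_of_nonneg_left (pow_le_sqrt_pow hn (by omega)) (by positivity)

/-- One more length is allowed than in `exists_card_walks_le`, and the linear relation removes it
again. The constant does not depend on `w` or `b`, so the bound can be summed over values of `b`. -/
theorem exists_card_constrained_walks_le (K M : ℕ) : ∃ C : ℝ, 0 ≤ C ∧ ∀ n, 0 < n →
    ∀ (w : Fin K → ℤ) (b : ℤ) (W : Finset (Fin (K + 1) → Fin n)),
      (∀ p ∈ W, 2 * numValues (stepLength p) ≤ M + 2) →
      (∀ p ∈ W, ∑ i, w i * walkStep p i = b) →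
      (∀ p ∈ W, ∃ i₀, walkStep p i₀ = 0 ∨
        ∑ i with (walkStep p i).natAbs = (walkStep p i₀).natAbs, w i * walkStep p i ≠ 0) →
      (W.card : ℝ) ≤ C * Real.sqrt n ^ (M + 2) := by
  refine ⟨(((M / 2 + 1) ^ K * 2 ^ K * 2 : ℕ) : ℝ), by positivity, fun n hn w b W hW hb hne => ?_⟩
  have h := card_le_of_linear_constraint (j := M / 2) hn w b (W.image walkStep)
    (by simpa using fun p _ => walkStep_natAbs_lt p)
    (by
      intro d hd
      obtain ⟨p, hp, rfl⟩ := Finset.mem_image.1 hd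
      have := hW p hp
      change numValues (stepLength p) ≤ _
      omega)
    (by simpa using hb) (by simpa using hne)
  rw [Fintype.card_fin] at h
  have h2 : W.card ≤ ((M / 2 + 1) ^ K * 2 ^ K * 2) * n ^ (M / 2 + 1) :=
    (card_walks_le W).trans ((Nat.mul_le_mul_left n h).trans (le_of_eq (by ring)))
  calc (W.card : ℝ) ≤ (((M / 2 + 1) ^ K * 2 ^ K * 2 : ℕ) : ℝ) * ((n ^ (M / 2 + 1) : ℕ) : ℝ) := by
        exact_mod_cast h2
    _ ≤ _ := mul_le_mul_of_nonneg_left (pow_le_sqrt_pow hn (by omega)) (by positivity)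

/-- The steps of a pair of walks. -/
def pairStep {n K : ℕ} (p : (Fin (K + 1) → Fin n) × (Fin (K + 1) → Fin n)) :
    Fin K ⊕ Fin K → ℤ := Sum.elim (walkStep p.1) (walkStep p.2)

theorem pairStep_natAbs_lt {n K : ℕ} (p : (Fin (K + 1) → Fin n) × (Fin (K + 1) → Fin n))
    (i : Fin K ⊕ Fin K) : (pairStep p i).natAbs < n := by
  cases i <;> exact walkStep_natAbs_lt _ _

theorem exists_card_walk_pairs_le (K M : ℕ) : ∃ C : ℝ, 0 ≤ C ∧ ∀ n, 0 < n →
    ∀ W : Finset ((Fin (K + 1) → Fin n) × (Fin (K + 1) → Fin n)),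
      (∀ p ∈ W, 2 * numValues (fun i => (pairStep p i).natAbs) ≤ M) →
      (W.card : ℝ) ≤ C * Real.sqrt n ^ (M + 4) := by
  refine ⟨(((M / 2) ^ (K + K) * 2 ^ (K + K) : ℕ) : ℝ), by positivity, fun n hn W hW => ?_⟩
  have h := card_le_of_numValues_le (j := M / 2) hn (W.image pairStep)
    (by
      intro d hd
      obtain ⟨p, hp, rfl⟩ := Finset.mem_image.1 hd
      exact pairStep_natAbs_lt p)
    (by
      intro d hd
      obtain ⟨p, hp, rfl⟩ := Finset.mem_image.1 hd
      have := hW p hp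
      omega)
  rw [Fintype.card_sum, Fintype.card_fin] at h
  have h2 : W.card ≤ ((M / 2) ^ (K + K) * 2 ^ (K + K)) * n ^ (M / 2 + 2) :=
    (card_walk_pairs_le W).trans ((Nat.mul_le_mul_left _ h).trans (le_of_eq (by ring)))
  calc (W.card : ℝ) ≤ (((M / 2) ^ (K + K) * 2 ^ (K + K) : ℕ) : ℝ) *
        ((n ^ (M / 2 + 2) : ℕ) : ℝ) := by exact_mod_cast h2
    _ ≤ _ := mul_le_mul_of_nonneg_left (pow_le_sqrt_pow hn (by omega)) (by positivity)

theorem exists_card_constrained_walk_pairs_le (K M : ℕ) : ∃ C : ℝ, 0 ≤ C ∧ ∀ n, 0 < n →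
    ∀ (w : Fin K ⊕ Fin K → ℤ) (b : ℤ)
      (W : Finset ((Fin (K + 1) → Fin n) × (Fin (K + 1) → Fin n))),
      (∀ p ∈ W, 2 * numValues (fun i => (pairStep p i).natAbs) ≤ M + 2) →
      (∀ p ∈ W, ∑ i, w i * pairStep p i = b) →
      (∀ p ∈ W, ∃ i₀, pairStep p i₀ = 0 ∨
        ∑ i with (pairStep p i).natAbs = (pairStep p i₀).natAbs, w i * pairStep p i ≠ 0) →
      (W.card : ℝ) ≤ C * Real.sqrt n ^ (M + 4) := by
  refine ⟨(((M / 2 + 1) ^ (K + K) * 2 ^ (K + K) * 2 : ℕ) : ℝ), by positivity,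
    fun n hn w b W hW hb hne => ?_⟩
  have h := card_le_of_linear_constraint (j := M / 2) hn w b (W.image pairStep)
    (by
      intro d hd
      obtain ⟨p, hp, rfl⟩ := Finset.mem_image.1 hd
      exact pairStep_natAbs_lt p)
    (by
      intro d hd
      obtain ⟨p, hp, rfl⟩ := Finset.mem_image.1 hd
      have := hW p hp
      omega)
    (by
      intro d hd
      obtain ⟨p, hp, rfl⟩ := Finset.mem_image.1 hd
      exact hb p hp)
    (by
      intro d hd
      obtain ⟨p, hp, rfl⟩ := Finset.mem_image.1 hd
      exact hne p hp)
  rw [Fintype.card_sum, Fintype.card_fin] at h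
  have h2 : W.card ≤ ((M / 2 + 1) ^ (K + K) * 2 ^ (K + K) * 2) * n ^ (M / 2 + 2) :=
    (card_walk_pairs_le W).trans ((Nat.mul_le_mul_left _ h).trans (le_of_eq (by ring)))
  calc (W.card : ℝ) ≤ (((M / 2 + 1) ^ (K + K) * 2 ^ (K + K) * 2 : ℕ) : ℝ) *
        ((n ^ (M / 2 + 2) : ℕ) : ℝ) := by exact_mod_cast h2
    _ ≤ _ := mul_le_mul_of_nonneg_left (pow_le_sqrt_pow hn (by omega)) (by positivity)

/-! ### Expectations along walks -/

section WalkMean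

variable {Ω : Type*}

theorem walkWeight_mul_walkWeight (a : ℕ → ℕ → Ω → ℝ) {n K L : ℕ} (p : Fin (K + 1) → Fin n)
    (q : Fin (L + 1) → Fin n) (ω : Ω) : walkWeight a p ω * walkWeight a q ω =
      ∏ i : Fin K ⊕ Fin L, entry a
        (Sum.elim (fun i => (p i.castSucc : ℕ)) (fun i => (q i.castSucc : ℕ)) i)
        (Sum.elim (fun i => (p i.succ : ℕ)) (fun i => (q i.succ : ℕ)) i) ω := by
  rw [Fintype.prod_sum_type]
  rfl

variable [MeasurableSpace Ω] {P : Measure Ω} [IsProbabilityMeasure P]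
  {a : ℕ → ℕ → Ω → ℝ}

namespace IsDiagonalArray

theorem integrable_walkWeight (ha : IsDiagonalArray P a) {n K : ℕ} (p : Fin (K + 1) → Fin n) :
    Integrable (walkWeight a p) P :=
  ha.integrable_prod Finset.univ (fun i : Fin K => (p i.castSucc : ℕ)) fun i => (p i.succ : ℕ)

theorem integrable_tracePow (ha : IsDiagonalArray P a) (n K : ℕ) :
    Integrable (tracePow a n K) P :=
  integrable_finsetSum _ fun p _ => ha.integrable_walkWeight p

theorem integral_tracePow (ha : IsDiagonalArray P a) (n K : ℕ) :
    ∫ ω, tracePow a n K ω ∂P = ∑ p ∈ closedWalks n K, ∫ ω, walkWeight a p ω ∂P :=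
  integral_finsetSum _ fun p _ => ha.integrable_walkWeight p

theorem integral_walkWeight_eq_zero (ha : IsDiagonalArray P a) {n K : ℕ}
    {p : Fin (K + 1) → Fin n} (hp : ¬ NoSingleton (stepLength p)) :
    ∫ ω, walkWeight a p ω ∂P = 0 := by
  unfold NoSingleton at hp
  push Not at hp
  obtain ⟨i, hi⟩ := hp
  exact ha.integral_prod_eq_zero Finset.univ (fun i : Fin K => (p i.castSucc : ℕ))
    (fun i => (p i.succ : ℕ)) (Finset.mem_univ i) fun j _ hj => hi j hj

theorem integrable_walkWeight_mul (ha : IsDiagonalArray P a) {n K L : ℕ}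
    (p : Fin (K + 1) → Fin n) (q : Fin (L + 1) → Fin n) :
    Integrable (fun ω => walkWeight a p ω * walkWeight a q ω) P := by
  simp_rw [walkWeight_mul_walkWeight]
  exact ha.integrable_prod Finset.univ _ _

theorem integrable_tracePow_mul (ha : IsDiagonalArray P a) (n K L : ℕ) :
    Integrable (fun ω => tracePow a n K ω * tracePow a n L ω) P := by
  simp_rw [tracePow, Finset.sum_mul_sum]
  exact integrable_finsetSum _ fun p _ => integrable_finsetSum _ fun q _ =>
    ha.integrable_walkWeight_mul p q

theorem integral_tracePow_mul (ha : IsDiagonalArray P a) (n K L : ℕ) :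
    ∫ ω, tracePow a n K ω * tracePow a n L ω ∂P =
      ∑ p ∈ closedWalks n K, ∑ q ∈ closedWalks n L,
        ∫ ω, walkWeight a p ω * walkWeight a q ω ∂P := by
  simp_rw [tracePow, Finset.sum_mul_sum]
  rw [integral_finsetSum _ fun p _ => integrable_finsetSum _ fun q _ =>
    ha.integrable_walkWeight_mul p q]
  exact Finset.sum_congr rfl fun p _ => integral_finsetSum _ fun q _ =>
    ha.integrable_walkWeight_mul p q

/-- The weights of two walks are correlated only if the walks have a step length in common and
no step length is taken only once. -/
theorem exists_common_of_correlated (ha : IsDiagonalArray P a) {n K : ℕ}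
    {p : (Fin (K + 1) → Fin n) × (Fin (K + 1) → Fin n)}
    (h : ∫ ω, walkWeight a p.1 ω * walkWeight a p.2 ω ∂P ≠
      (∫ ω, walkWeight a p.1 ω ∂P) * ∫ ω, walkWeight a p.2 ω ∂P) :
    NoSingleton (fun i => (pairStep p i).natAbs) ∧
      ∃ i j, stepLength p.1 i = stepLength p.2 j := by
  set x : Fin K ⊕ Fin K → ℕ :=
    Sum.elim (fun i => (p.1 i.castSucc : ℕ)) (fun i => (p.2 i.castSucc : ℕ)) with hx
  set y : Fin K ⊕ Fin K → ℕ :=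
    Sum.elim (fun i => (p.1 i.succ : ℕ)) (fun i => (p.2 i.succ : ℕ)) with hy
  have hstep (i : Fin K ⊕ Fin K) : ((y i : ℤ) - x i).natAbs = (pairStep p i).natAbs := by
    cases i <;> rfl
  constructor
  · by_contra hs
    unfold NoSingleton at hs
    push Not at hs
    obtain ⟨i, hi⟩ := hs
    apply h
    have h1 : ∫ ω, walkWeight a p.1 ω * walkWeight a p.2 ω ∂P = 0 := by
      simp_rw [walkWeight_mul_walkWeight]
      refine ha.integral_prod_eq_zero Finset.univ x y (Finset.mem_univ i) fun j _ hj => ?_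
      rw [hstep, hstep]
      exact hi j hj
    rw [h1, eq_comm, mul_eq_zero]
    -- A step length taken once in the pair is taken once in the walk it belongs to, so the product
    -- of the two means vanishes as well.
    rcases i with i | i
    · left
      refine ha.integral_walkWeight_eq_zero fun hns => ?_
      obtain ⟨j, hj, hr⟩ := hns i
      exact hi (Sum.inl j) (by simpa using hj) hr
    · right
      refine ha.integral_walkWeight_eq_zero fun hns => ?_
      obtain ⟨j, hj, hr⟩ := hns i
      exact hi (Sum.inr j) (by simpa using hj) hr
  · by_contra! hs
    apply h
    have h1 := ha.integral_prod_mul_prod (Finset.univ.map Function.Embedding.inl)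
      (Finset.univ.map Function.Embedding.inr) x y (by
        intro i hi j hj
        obtain ⟨i, -, rfl⟩ := Finset.mem_map.1 hi
        obtain ⟨j, -, rfl⟩ := Finset.mem_map.1 hj
        exact hs i j)
    simp only [Finset.prod_map] at h1
    exact h1

theorem exists_abs_walk_cov_le (ha : IsDiagonalArray P a) (K : ℕ) :
    ∃ C : ℝ, 0 ≤ C ∧ ∀ (n : ℕ) (p : (Fin (K + 1) → Fin n) × (Fin (K + 1) → Fin n)),
      |∫ ω, walkWeight a p.1 ω * walkWeight a p.2 ω ∂P -
        (∫ ω, walkWeight a p.1 ω ∂P) * ∫ ω, walkWeight a p.2 ω ∂P| ≤ C := by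
  obtain ⟨C, hC, h⟩ := ha.exists_abs_integral_prod_le (K + K)
  refine ⟨C + C * C, by positivity, fun n p => ?_⟩
  refine (abs_sub _ _).trans (add_le_add ?_ ?_)
  · simp_rw [walkWeight_mul_walkWeight]
    exact h _ _ _ _ (by simp)
  · rw [abs_mul]
    exact mul_le_mul (h _ Finset.univ _ _ (by simp)) (h _ Finset.univ _ _ (by simp))
      (abs_nonneg _) hC

/-- Correlated pairs of walks share a step length. Either the pair has fewer distinct lengths than
half its steps, or every length occurs exactly twice. In the latter case a shared length occurs once
in each walk, so closing up the first walk is a non-trivial relation. In both cases a factor `n` is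
lost against the product of two traces. -/
theorem exists_tracePow_variance_le (ha : IsDiagonalArray P a) (K : ℕ) :
    ∃ C : ℝ, 0 ≤ C ∧ ∀ n, 0 < n →
      ∫ ω, tracePow a n K ω * tracePow a n K ω ∂P -
        (∫ ω, tracePow a n K ω ∂P) * ∫ ω, tracePow a n K ω ∂P ≤
          C * Real.sqrt n ^ (2 * K + 2) := by
  cases K with
  | zero =>
    refine ⟨0, le_rfl, fun n _ => ?_⟩
    simp [tracePow, walkWeight]
  | succ k =>
  obtain ⟨C, hC, hcov⟩ := ha.exists_abs_walk_cov_le (k + 1)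
  obtain ⟨C₁, hC₁, h₁⟩ := exists_card_walk_pairs_le (k + 1) (2 * k)
  obtain ⟨C₂, hC₂, h₂⟩ := exists_card_constrained_walk_pairs_le (k + 1) (2 * k)
  refine ⟨(C₁ + C₂) * C, by positivity, fun n hn => ?_⟩
  rw [ha.integral_tracePow_mul, ha.integral_tracePow, Finset.sum_mul_sum,
    ← Finset.sum_sub_distrib]
  simp_rw [← Finset.sum_sub_distrib]
  rw [← Finset.sum_product']
  set g : (Fin (k + 1 + 1) → Fin n) × (Fin (k + 1 + 1) → Fin n) → ℝ := fun p =>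
    ∫ ω, walkWeight a p.1 ω * walkWeight a p.2 ω ∂P -
      (∫ ω, walkWeight a p.1 ω ∂P) * ∫ ω, walkWeight a p.2 ω ∂P with hg
  set W := (closedWalks n (k + 1) ×ˢ closedWalks n (k + 1)).filter fun p => g p ≠ 0 with hW
  set W₁ := W.filter fun p => 2 * numValues (fun i => (pairStep p i).natAbs) ≤ 2 * k
  set W₂ := W.filter fun p => ¬ 2 * numValues (fun i => (pairStep p i).natAbs) ≤ 2 * k with hW₂
  have hprop (p) (hp : p ∈ W) : p.1 ∈ closedWalks n (k + 1) ∧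
      NoSingleton (fun i => (pairStep p i).natAbs) ∧
      ∃ i j, stepLength p.1 i = stepLength p.2 j := by
    rw [hW, Finset.mem_filter, Finset.mem_product] at hp
    exact ⟨hp.1.1, ha.exists_common_of_correlated (sub_ne_zero.1 hp.2)⟩
  have c₁ := h₁ n hn W₁ fun p hp => (Finset.mem_filter.1 hp).2
  -- The linear form is the closing condition of the first walk; it ignores the second.
  have c₂ := h₂ n hn (Sum.elim (fun _ => 1) fun _ => 0) 0 W₂
    (fun p hp => by
      have := (hprop p (Finset.mem_filter.1 hp).1).2.1.two_mul_numValues_le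
      simp only [Fintype.card_sum, Fintype.card_fin] at this
      omega)
    (fun p hp => by
      simpa [pairStep] using sum_walkStep_of_mem (hprop p (Finset.mem_filter.1 hp).1).1)
    (fun p hp => by
      obtain ⟨hpW, hlt⟩ := Finset.mem_filter.1 hp
      obtain ⟨-, hns, i, j, hij⟩ := hprop p hpW
      refine ⟨Sum.inl i, ?_⟩
      by_cases h0 : pairStep p (Sum.inl i) = 0
      · exact Or.inl h0
      · right
        -- The two occurrences of the common length are one step of each walk, so the form picks up
        -- a single non-zero step.
        have hfil : (Finset.univ.filter fun l => (pairStep p l).natAbs =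
            (pairStep p (Sum.inl i)).natAbs) = {Sum.inl i, Sum.inr j} := by
          ext l
          simp only [Finset.mem_filter, Finset.mem_univ, true_and, Finset.mem_insert,
            Finset.mem_singleton]
          constructor
          · intro hl
            by_cases hli : l = Sum.inl i
            · exact Or.inl hli
            · refine Or.inr (hns.eq_of_eq ?_ hl hij.symm hli (by simp))
              simp only [Fintype.card_sum, Fintype.card_fin]
              omega
          · rintro (rfl | rfl)
            · rfl
            · exact hij.symm
        rw [hfil, Finset.sum_pair (by simp)]
        simpa using h0)
  have hcard : (W.card : ℝ) = W₁.card + W₂.card := by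
    rw [← Finset.card_filter_add_card_filter_not (s := W)
      (fun p => 2 * numValues (fun i => (pairStep p i).natAbs) ≤ 2 * k)]
    push_cast
    rfl
  calc ∑ p ∈ closedWalks n (k + 1) ×ˢ closedWalks n (k + 1), g p = ∑ p ∈ W, g p :=
        (Finset.sum_filter_ne_zero _).symm
    _ ≤ ∑ p ∈ W, C := Finset.sum_le_sum fun p _ => (le_abs_self _).trans (hcov n p)
    _ = W.card * C := by rw [Finset.sum_const, nsmul_eq_mul]
    _ ≤ (C₁ * Real.sqrt n ^ (2 * k + 4) + C₂ * Real.sqrt n ^ (2 * k + 4)) * C := by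
        rw [hcard]
        gcongr
    _ = _ := by ring

end IsDiagonalArray

end WalkMean

/-! ### Removing the first step of a walk and its partner -/

section Recursion

theorem abs_sum_le_of_support {α : Type*} {s W : Finset α} {f : α → ℝ} {C : ℝ} (hC : 0 ≤ C)
    (h : ∀ p ∈ s, p ∉ W → f p = 0) (hb : ∀ p ∈ s, |f p| ≤ C) : |∑ p ∈ s, f p| ≤ W.card * C := by
  classical
  calc |∑ p ∈ s, f p| = |∑ p ∈ s ∩ W, f p| := by
        rw [Finset.sum_subset Finset.inter_subset_left]
        intro p hp hpW
        exact h p hp fun hW => hpW (Finset.mem_inter.2 ⟨hp, hW⟩)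
    _ ≤ ∑ p ∈ s ∩ W, |f p| := Finset.abs_sum_le_sum_abs _ _
    _ ≤ ∑ _p ∈ s ∩ W, C := Finset.sum_le_sum fun p hp => hb p (Finset.mem_inter.1 hp).1
    _ = (s ∩ W).card * C := by rw [Finset.sum_const, nsmul_eq_mul]
    _ ≤ W.card * C := by
        gcongr
        exact Finset.inter_subset_right

/-- The step lengths of the walk occur exactly in pairs. -/
def IsPaired {n K : ℕ} (p : Fin (K + 1) → Fin n) : Prop :=
  NoSingleton (stepLength p) ∧ K ≤ 2 * numValues (stepLength p)

theorem IsPaired.eq_of_eq {n K : ℕ} {p : Fin (K + 1) → Fin n} (h : IsPaired p) {i j l : Fin K}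
    (hj : stepLength p j = stepLength p i) (hl : stepLength p l = stepLength p i) (hji : j ≠ i)
    (hli : l ≠ i) : j = l :=
  h.1.eq_of_eq (by simpa using h.2) hj hl hji hli

theorem IsPaired.two_mul_numValues_le {n K : ℕ} {p : Fin (K + 1) → Fin n} (h : IsPaired p) :
    2 * numValues (stepLength p) ≤ K := by
  simpa using h.1.two_mul_numValues_le

theorem IsPaired.filter_eq {n K : ℕ} {p : Fin (K + 1) → Fin n} (h : IsPaired p) {i j : Fin K}
    (hj : stepLength p j = stepLength p i) (hji : j ≠ i) :
    (Finset.univ.filter fun l => (walkStep p l).natAbs = (walkStep p i).natAbs) = {i, j} := by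
  ext l
  simp only [Finset.mem_filter, Finset.mem_univ, true_and, Finset.mem_insert,
    Finset.mem_singleton]
  constructor
  · intro hl
    by_cases hli : l = i
    · exact Or.inl hli
    · exact Or.inr (h.eq_of_eq hl hj hli hji)
  · rintro (rfl | rfl)
    · rfl
    · exact hj

open Classical in
/-- The closed walks with too few distinct steps, or with steps in a non-trivial linear relation. -/
noncomputable def degenerateWalks (n k : ℕ) : Finset (Fin (k + 2) → Fin n) :=
  (closedWalks n (k + 1)).filter fun p => 2 * numValues (stepLength p) ≤ k ∨
    (2 * numValues (stepLength p) ≤ k + 1 ∧ ∃ i₀, walkStep p i₀ = 0 ∨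
      ∑ i with (walkStep p i).natAbs = (walkStep p i₀).natAbs, walkStep p i ≠ 0)

/-- In the second case of the definition the relation is the closing condition of the walk. The
bound is a factor `√n` below the normalization `√n ^ (k + 3)` of a trace of order `k + 1`. -/
theorem exists_card_degenerateWalks_le (k : ℕ) : ∃ C : ℝ, 0 ≤ C ∧ ∀ n, 0 < n →
    ((degenerateWalks n k).card : ℝ) ≤ C * Real.sqrt n ^ (k + 2) := by
  obtain ⟨C₁, hC₁, h₁⟩ := exists_card_walks_le (k + 1) k
  obtain ⟨C₂, hC₂, h₂⟩ := exists_card_constrained_walks_le (k + 1) k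
  refine ⟨C₁ + C₂, by positivity, fun n hn => ?_⟩
  classical
  rw [degenerateWalks, Finset.filter_or]
  have c₁ := h₁ n hn ((closedWalks n (k + 1)).filter fun p => 2 * numValues (stepLength p) ≤ k)
    fun p hp => (Finset.mem_filter.1 hp).2
  have c₂ := h₂ n hn (fun _ => 1) 0 ((closedWalks n (k + 1)).filter fun p =>
    2 * numValues (stepLength p) ≤ k + 1 ∧ ∃ i₀, walkStep p i₀ = 0 ∨
      ∑ i with (walkStep p i).natAbs = (walkStep p i₀).natAbs, walkStep p i ≠ 0)
    (fun p hp => (Finset.mem_filter.1 hp).2.1.trans (by omega))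
    (fun p hp => by simpa using sum_walkStep_of_mem (Finset.mem_filter.1 hp).1)
    (fun p hp => by simpa using (Finset.mem_filter.1 hp).2.2)
  refine (Nat.cast_le.2 (Finset.card_union_le _ _)).trans ?_
  push_cast
  linarith

/-- The closed walks that retrace their first step at the step `j`. -/
def retracingWalks (n k : ℕ) (j : Fin (k + 1)) : Finset (Fin (k + 2) → Fin n) :=
  (closedWalks n (k + 1)).filter fun p =>
    p j.succ = p 0 ∧ p j.castSucc = p (0 : Fin (k + 1)).succ

open Classical in
/-- The paired closed walks in which step `j` is opposite to the first one, but does not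
retrace it. -/
noncomputable def crossingWalks (n k : ℕ) (j : Fin (k + 1)) : Finset (Fin (k + 2) → Fin n) :=
  (closedWalks n (k + 1)).filter fun p =>
    IsPaired p ∧ walkStep p j = -walkStep p 0 ∧ walkStep p 0 ≠ 0 ∧ p j.succ ≠ p 0

variable {Ω : Type*}

/-- The product of the entries along a walk, without the first step and the step `j`. -/
noncomputable def restWeight (a : ℕ → ℕ → Ω → ℝ) {n k : ℕ} (j : Fin (k + 1))
    (p : Fin (k + 2) → Fin n) (ω : Ω) : ℝ :=
  ∏ i ∈ ({0, j} : Finset (Fin (k + 1)))ᶜ, entry a (p i.castSucc) (p i.succ) ω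

/-- The part of a walk between the first step and the step `i + 1`. -/
def innerWalk {n k : ℕ} (i : Fin k) (p : Fin (k + 2) → Fin n) : Fin (i + 1) → Fin n :=
  fun l => p ⟨l + 1, by omega⟩

/-- The part of a walk after the step `i + 1`. -/
def outerWalk {n k : ℕ} (i : Fin k) (p : Fin (k + 2) → Fin n) : Fin (k - 1 - i + 1) → Fin n :=
  fun l => p ⟨l + i + 2, by omega⟩

/-- The walk that goes around `q'`, with the detour `q` inserted. -/
def joinWalks {n k : ℕ} (i : Fin k) (q : Fin (i + 1) → Fin n)
    (q' : Fin (k - 1 - i + 1) → Fin n) : Fin (k + 2) → Fin n := fun l =>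
  -- The vertex `q' 0` is visited at times `0` and `i + 2`, and the closed walk `q` occupies times
  -- `1` to `i + 1`. For closed `q`, step `i + 1` therefore reverses step `0`.
  if (l : ℕ) = 0 then q' 0 else if h : (l : ℕ) ≤ i + 1 then q ⟨l - 1, by omega⟩
    else q' ⟨l - i - 2, by omega⟩

/-- Removing steps `0` and `i + 1` leaves steps `1, …, i` for the inner part and `i + 2, …, k` for
the outer part. -/
theorem restWeight_eq_mul (a : ℕ → ℕ → Ω → ℝ) {n k : ℕ} (i : Fin k) (p : Fin (k + 2) → Fin n)
    (ω : Ω) : restWeight a i.succ p ω =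
      walkWeight a (innerWalk i p) ω * walkWeight a (outerWalk i p) ω := by
  rw [walkWeight_mul_walkWeight, restWeight, eq_comm]
  refine Finset.prod_bij (fun l _ => Sum.elim (fun l : Fin i => (⟨l + 1, by omega⟩ : Fin (k + 1)))
    (fun l : Fin (k - 1 - i) => (⟨l + i + 2, by omega⟩ : Fin (k + 1))) l) ?_ ?_ ?_ ?_
  · rintro (l | l) -
    · have := l.2
      simp [Fin.ext_iff]
      omega
    · simp [Fin.ext_iff]
      omega
  · rintro (l | l) - (l' | l') - h
    · simp only [Sum.elim_inl, Fin.mk.injEq] at h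
      exact congrArg _ (Fin.ext (by omega))
    · have := l.2
      simp only [Sum.elim_inl, Sum.elim_inr, Fin.mk.injEq] at h
      omega
    · have := l'.2
      simp only [Sum.elim_inl, Sum.elim_inr, Fin.mk.injEq] at h
      omega
    · simp only [Sum.elim_inr, Fin.mk.injEq] at h
      exact congrArg _ (Fin.ext (by omega))
  · intro l hl
    simp only [Finset.mem_compl, Finset.mem_insert, Finset.mem_singleton, not_or, Fin.ext_iff,
      Fin.val_zero, Fin.val_succ] at hl
    by_cases h : (l : ℕ) ≤ i
    · exact ⟨Sum.inl ⟨l - 1, by omega⟩, Finset.mem_univ _, Fin.ext (by simp; omega)⟩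
    · exact ⟨Sum.inr ⟨l - i - 2, by omega⟩, Finset.mem_univ _, Fin.ext (by simp; omega)⟩
  · rintro (l | l) -
    · rfl
    · simp only [Sum.elim_inr, outerWalk, Fin.succ_mk, Fin.castSucc_mk, Fin.val_succ,
        Fin.val_castSucc]
      congr 4
      omega

/-- Retracing the first step is exactly what makes both the inner and the outer part of a closed
walk closed, and `joinWalks` inverts the cutting. -/
theorem sum_retracingWalks {n k : ℕ} (i : Fin k) (g : (Fin (i + 1) → Fin n) →
    (Fin (k - 1 - i + 1) → Fin n) → ℝ) :
    ∑ p ∈ retracingWalks n k i.succ, g (innerWalk i p) (outerWalk i p) =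
      ∑ q ∈ closedWalks n i, ∑ q' ∈ closedWalks n (k - 1 - i), g q q' := by
  rw [← Finset.sum_product']
  have hik := i.2
  refine Finset.sum_bij' (fun p _ => (innerWalk i p, outerWalk i p))
    (fun q _ => joinWalks i q.1 q.2) ?_ ?_ ?_ ?_ ?_
  · intro p hp
    simp only [retracingWalks, closedWalks, Finset.mem_filter, Finset.mem_univ, true_and] at hp
    obtain ⟨h0, h1, h2⟩ := hp
    simp only [closedWalks, Finset.mem_product, Finset.mem_filter, Finset.mem_univ, true_and,
      innerWalk, outerWalk]
    constructor
    · exact h2.symm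
    · rw [h0] at h1
      convert h1 using 2
      · exact Fin.ext (by simp)
      · exact Fin.ext (by simp; omega)
  · rintro ⟨q, q'⟩ hq
    simp only [closedWalks, Finset.mem_product, Finset.mem_filter, Finset.mem_univ,
      true_and] at hq
    simp only [retracingWalks, closedWalks, Finset.mem_filter, Finset.mem_univ, true_and]
    refine ⟨?_, ?_, ?_⟩
    · have h1 : ¬ k + 1 ≤ (i : ℕ) + 1 := by omega
      simp only [joinWalks, Fin.val_zero, if_true, Fin.val_last, Nat.add_eq_zero_iff, one_ne_zero,
        and_false, if_false, h1, dite_false]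
      rw [hq.2]
      congr 1
      exact Fin.ext (by simp; omega)
    · simp only [joinWalks, Fin.val_succ, Fin.val_zero, if_true]
      rw [if_neg (by omega), dif_neg (by omega)]
      congr 1
      exact Fin.ext (by simp; omega)
    · simp only [joinWalks, Fin.val_castSucc, Fin.val_succ, Fin.val_zero]
      simp only [Nat.add_eq_zero_iff, one_ne_zero, and_false, if_false, le_refl, dite_true,
        Nat.add_sub_cancel, zero_add, le_add_iff_nonneg_left, zero_le]
      convert hq.1.symm using 2
      · exact Fin.ext (by simp)
      · exact Fin.ext (by simp)
  · intro p hp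
    simp only [retracingWalks, closedWalks, Finset.mem_filter, Finset.mem_univ, true_and] at hp
    obtain ⟨h0, h1, h2⟩ := hp
    funext l
    simp only [joinWalks, innerWalk, outerWalk]
    split_ifs with hl hl'
    · rw [← show (0 : Fin (k + 2)) = l from Fin.ext hl.symm, ← h1]
      congr 1
      exact Fin.ext (by simp)
    · congr 1
      exact Fin.ext (by simp; omega)
    · congr 1
      exact Fin.ext (by simp; omega)
  · rintro ⟨q, q'⟩ hq
    refine Prod.ext ?_ ?_
    · funext l
      have : (l : ℕ) ≤ i := Nat.lt_succ_iff.1 l.2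
      simp [innerWalk, joinWalks, this]
    · funext l
      have h1 : ¬ (l : ℕ) + i + 2 ≤ i + 1 := by omega
      simp only [outerWalk, joinWalks, h1, dite_false]
      rw [if_neg (by omega)]
      congr 1
      exact Fin.ext (by simp; omega)
  · intro p hp
    rfl

variable [MeasurableSpace Ω] {P : Measure Ω} [IsProbabilityMeasure P] {a : ℕ → ℕ → Ω → ℝ}

namespace IsDiagonalArray

theorem sum_retracingWalks_integral (ha : IsDiagonalArray P a) {n k : ℕ} (i : Fin k) :
    ∑ p ∈ retracingWalks n k i.succ, ∫ ω, restWeight a i.succ p ω ∂P =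
      ∫ ω, tracePow a n i ω * tracePow a n (k - 1 - i) ω ∂P := by
  simp_rw [restWeight_eq_mul]
  rw [ha.integral_tracePow_mul, ← sum_retracingWalks i fun q q' =>
    ∫ ω, walkWeight a q ω * walkWeight a q' ω ∂P]

/-- In a paired walk no third step uses the diagonal of the first one, so the pair is independent of
the remaining steps. -/
theorem integral_walkWeight_eq_mul (ha : IsDiagonalArray P a) {n k : ℕ} {p : Fin (k + 2) → Fin n}
    (hp : IsPaired p) {j : Fin (k + 1)} (hj0 : j ≠ 0) (hj : stepLength p j = stepLength p 0) :
    ∫ ω, walkWeight a p ω ∂P =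
      (∫ ω, entry a (p 0) (p (0 : Fin (k + 1)).succ) ω * entry a (p j.castSucc) (p j.succ) ω ∂P) *
        ∫ ω, restWeight a j p ω ∂P := by
  have h := ha.integral_prod_mul_prod {0, j} ({0, j} : Finset (Fin (k + 1)))ᶜ
    (fun i : Fin (k + 1) => (p i.castSucc : ℕ)) (fun i => (p i.succ : ℕ)) (by
      intro i hi l hl h
      have hi' : stepLength p i = stepLength p 0 := by
        rcases Finset.mem_insert.1 hi with rfl | hi
        · rfl
        · rw [Finset.mem_singleton.1 hi, hj]
      have hl' : l ≠ 0 ∧ l ≠ j := by simpa using hl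
      have h' : stepLength p i = stepLength p l := h
      exact hl'.2 (hp.eq_of_eq (h'.symm.trans hi') hj hl'.1 hj0))
  simp only [Finset.prod_pair hj0.symm] at h
  simp only [restWeight]
  rw [← Fin.castSucc_zero, ← h]
  congr 1
  funext ω
  rw [← Finset.prod_pair hj0.symm (f := fun i => entry a (p i.castSucc) (p i.succ) ω),
    Finset.prod_mul_prod_compl, walkWeight]

end IsDiagonalArray

end Recursion

/-! ### Recursion for expected traces and the size of the crossing terms -/

section Moments

variable {Ω : Type*}

/-- The `K`-th moment of the empirical spectral distribution. -/
noncomputable def esdMoment (a : ℕ → ℕ → Ω → ℝ) (n K : ℕ) (ω : Ω) : ℝ := ∫ x, x ^ K ∂(esd a n ω)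

theorem esdMoment_eq (a : ℕ → ℕ → Ω → ℝ) (n K : ℕ) (ω : Ω) :
    esdMoment a n K ω = tracePow a n K ω / Real.sqrt n ^ (K + 2) := integral_pow_esd_eq a n ω K

variable [MeasurableSpace Ω] {P : Measure Ω} [IsProbabilityMeasure P]
  {a : ℕ → ℕ → Ω → ℝ}

theorem walkStep_eq_neg_of_mem_retracingWalks {n k : ℕ} {j : Fin (k + 1)}
    {p : Fin (k + 2) → Fin n} (h1 : p j.succ = p 0)
    (h2 : p j.castSucc = p (0 : Fin (k + 1)).succ) : walkStep p j = -walkStep p 0 := by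
  rw [walkStep, walkStep, h1, h2, Fin.castSucc_zero]
  ring

namespace IsDiagonalArray

/-- The expected trace of a power in terms of expected products of traces of smaller powers and of
the walks whose first step is opposite to another step that does not retrace it. -/
theorem exists_integral_tracePow_succ (ha : IsDiagonalArray P a) (k : ℕ) :
    ∃ C : ℝ, 0 ≤ C ∧ ∀ n, 0 < n →
      |∫ ω, tracePow a n (k + 1) ω ∂P -
        ∑ i : Fin k, ∫ ω, tracePow a n i ω * tracePow a n (k - 1 - i) ω ∂P -
        ∑ i : Fin k, ∑ p ∈ crossingWalks n k i.succ, ∫ ω, walkWeight a p ω ∂P| ≤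
          C * Real.sqrt n ^ (k + 2) := by
  classical
  obtain ⟨C, hC, hbound⟩ := ha.exists_abs_integral_prod_le (k + 1)
  obtain ⟨D, hD, hdeg⟩ := exists_card_degenerateWalks_le k
  refine ⟨D * (C + k * C + k * C), by positivity, fun n hn => ?_⟩
  have hww (p : Fin (k + 2) → Fin n) : |∫ ω, walkWeight a p ω ∂P| ≤ C :=
    hbound _ Finset.univ _ _ (by simp)
  have hrw (j : Fin (k + 1)) (p : Fin (k + 2) → Fin n) : |∫ ω, restWeight a j p ω ∂P| ≤ C :=
    hbound _ _ _ _ ((Finset.card_le_univ _).trans (by simp))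
  simp_rw [← ha.sum_retracingWalks_integral]
  rw [ha.integral_tracePow]
  simp_rw [retracingWalks, crossingWalks, Finset.sum_filter]
  rw [Finset.sum_comm, Finset.sum_comm (s := Finset.univ (α := Fin k))
    (t := closedWalks n (k + 1)) (f := fun i p => if IsPaired p ∧ _ then _ else _),
    ← Finset.sum_sub_distrib, ← Finset.sum_sub_distrib]
  -- The identity holds exactly, walk by walk, off the degenerate walks; on these each term is
  -- bounded.
  refine (abs_sum_le_of_support (W := degenerateWalks n k) (C := C + k * C + k * C) (by positivity)
    (fun p hp hpd => ?_) fun p hp => ?_).trans ?_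
  · simp only [degenerateWalks, Finset.mem_filter, hp, true_and, not_or, not_and, not_le] at hpd
    obtain ⟨hnv, hcl⟩ := hpd
    by_cases hpair : IsPaired p
    · have hcl' := hcl hpair.two_mul_numValues_le
      push Not at hcl'
      obtain ⟨hd0, hsum⟩ := hcl' 0
      obtain ⟨j, hj0, hj⟩ := hpair.1 0
      obtain ⟨i, rfl⟩ := Fin.exists_succ_eq.2 hj0
      -- Non-degeneracy says that the class of the first step sums to zero, so its partner is the
      -- opposite step.
      rw [hpair.filter_eq hj hj0, Finset.sum_pair hj0.symm] at hsum
      have huniq (l : Fin k) (hl : l ≠ i) : walkStep p l.succ ≠ -walkStep p 0 := by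
        intro h
        have : stepLength p l.succ = stepLength p 0 := by rw [stepLength, h, Int.natAbs_neg]; rfl
        exact hl (Fin.succ_injective _ (hpair.eq_of_eq this hj (Fin.succ_ne_zero _) hj0))
      rw [Finset.sum_eq_single i, Finset.sum_eq_single i]
      · by_cases hret : p i.succ.succ = p 0
        · have hret' : p i.succ.castSucc = p (0 : Fin (k + 1)).succ := by
            rw [walkStep, walkStep, hret, Fin.castSucc_zero] at hsum
            exact Fin.ext (by omega)
          rw [if_pos ⟨hret, hret'⟩, if_neg (by tauto), sub_zero,
            ha.integral_walkWeight_eq_mul hpair hj0 hj, hret, hret', entry_comm a (p _ : ℕ) (p 0)]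
          simp_rw [← pow_two]
          rw [ha.integral_entry_sq, one_mul, sub_self]
        · rw [if_neg (by tauto), if_pos ⟨hpair, by omega, hd0, hret⟩]
          ring
      · intro l _ hl
        rw [if_neg]
        rintro ⟨-, h, -⟩
        exact huniq l hl h
      · simp
      · intro l _ hl
        rw [if_neg]
        rintro ⟨h1, h2⟩
        exact huniq l hl (walkStep_eq_neg_of_mem_retracingWalks h1 h2)
      · simp
    -- Some length is taken only once. In a retracing walk that lone step is neither the first step
    -- nor its partner, so it survives in `restWeight`, whose mean then vanishes too.
    · have hns : ¬ NoSingleton (stepLength p) := fun h => hpair ⟨h, hnv⟩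
      rw [ha.integral_walkWeight_eq_zero hns]
      rw [Finset.sum_eq_zero, Finset.sum_eq_zero]
      · simp
      · intro i _
        rw [if_neg]
        tauto
      · intro i _
        split_ifs with h
        · have hst : stepLength p i.succ = stepLength p 0 := by
            rw [stepLength, walkStep_eq_neg_of_mem_retracingWalks h.1 h.2, Int.natAbs_neg]; rfl
          unfold NoSingleton at hns
          push Not at hns
          obtain ⟨l, hl⟩ := hns
          refine ha.integral_prod_eq_zero _ (fun i : Fin (k + 1) => (p i.castSucc : ℕ))
            (fun i => (p i.succ : ℕ)) (i := l) ?_ fun j _ hj => hl j hj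
          simp only [Finset.mem_compl, Finset.mem_insert, Finset.mem_singleton, not_or]
          constructor
          · rintro rfl
            exact hl i.succ (Fin.succ_ne_zero i) hst
          · rintro rfl
            exact hl 0 (Fin.succ_ne_zero i).symm hst.symm
        · rfl
  · have hsumle (q : Fin k → Prop) [DecidablePred q] (f : Fin k → ℝ) (hf : ∀ i, |f i| ≤ C) :
        |∑ i, if q i then f i else 0| ≤ k * C := by
      refine (Finset.abs_sum_le_sum_abs _ _).trans
        ((Finset.sum_le_sum (g := fun _ => C) fun i _ => ?_).trans (by simp))
      split_ifs
      · exact hf i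
      · simpa using hC
    refine (abs_sub _ _).trans (add_le_add ((abs_sub _ _).trans (add_le_add (hww p) ?_)) ?_)
    · exact hsumle _ _ fun i => hrw i.succ p
    · exact hsumle _ _ fun i => hww p
  · have := hdeg n hn
    calc _ ≤ (D * Real.sqrt n ^ (k + 2)) * (C + k * C + k * C) := by gcongr
      _ = _ := by ring

/-- Opposite steps of equal length are translates of the same edge, and the translation takes `p 0`
to `p j.succ`. It is also the distance of the two entries along their diagonal. -/
theorem integral_walkWeight_of_mem_crossingWalks (ha : IsDiagonalArray P a) {n k : ℕ}
    {p : Fin (k + 2) → Fin n} {j : Fin (k + 1)} (hj0 : j ≠ 0) (hp : p ∈ crossingWalks n k j) :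
    ∫ ω, walkWeight a p ω ∂P =
      corr P a (stepLength p 0) (((p j.succ : ℕ) : ℤ) - (p 0 : ℕ)).natAbs *
        ∫ ω, restWeight a j p ω ∂P := by
  simp only [crossingWalks, Finset.mem_filter] at hp
  obtain ⟨-, hpair, hstep, -, -⟩ := hp
  have hj : stepLength p j = stepLength p 0 := by rw [stepLength, hstep, Int.natAbs_neg]; rfl
  have hcov := ha.integral_entry_mul_entry (x := p 0) (y := p (0 : Fin (k + 1)).succ)
    (x' := p j.castSucc) (y' := p j.succ) hj.symm
  rw [ha.integral_walkWeight_eq_mul hpair hj0 hj, hcov]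
  congr 2
  rw [walkStep, walkStep, Fin.castSucc_zero] at hstep
  omega

/-- If the translation between the two steps is at least `T`, the correlation is small. A smaller
one takes at most `2 * T + 1` values, and prescribing a non-zero value is an additional linear
constraint. -/
theorem exists_abs_sum_crossingWalks_le (ha : IsDiagonalArray P a) (hdec : CorrDecay P a) {k : ℕ}
    {j : Fin (k + 1)} (hj0 : j ≠ 0) {ε : ℝ} (hε : 0 < ε) :
    ∃ D : ℝ, 0 ≤ D ∧ ∀ n, 0 < n →
      |∑ p ∈ crossingWalks n k j, ∫ ω, walkWeight a p ω ∂P| ≤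
        ε * Real.sqrt n ^ (k + 3) + D * Real.sqrt n ^ (k + 2) := by
  classical
  obtain ⟨C, hC, hbound⟩ := ha.exists_abs_integral_prod_le (k + 1)
  obtain ⟨C₁, hC₁, h₁⟩ := exists_card_walks_le (k + 1) (k + 1)
  obtain ⟨C₂, hC₂, h₂⟩ := exists_card_constrained_walks_le (k + 1) k
  -- `C₁` counts the walks and `C` bounds the remaining weight; the `+ 1` covers the case `C₁ * C =
  -- 0`.
  obtain ⟨η, hη, hηε⟩ : ∃ η : ℝ, 0 < η ∧ C₁ * (η * C) ≤ ε := by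
    refine ⟨ε / (C₁ * C + 1), by positivity, ?_⟩
    rw [show C₁ * (ε / (C₁ * C + 1) * C) = ε * ((C₁ * C) / (C₁ * C + 1)) by ring]
    exact mul_le_of_le_one_right hε.le ((div_le_one (by positivity)).2 (by linarith))
  obtain ⟨T, hT⟩ : ∃ T : ℕ, ∀ t, T ≤ t → ∀ r, |corr P a r t| ≤ η := by
    obtain ⟨T, hT⟩ := eventually_atTop.1 (Metric.tendstoUniformly_iff.1 hdec η hη)
    refine ⟨T, fun t ht r => ?_⟩
    have := hT t ht r
    rw [dist_comm, Real.dist_eq, sub_zero] at this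
    exact this.le
  refine ⟨(2 * T + 1) * C₂ * C, by positivity, fun n hn => ?_⟩
  have hww (p : Fin (k + 2) → Fin n) : |∫ ω, walkWeight a p ω ∂P| ≤ C :=
    hbound _ Finset.univ _ _ (by simp)
  have hrw (j : Fin (k + 1)) (p : Fin (k + 2) → Fin n) : |∫ ω, restWeight a j p ω ∂P| ≤ C :=
    hbound _ _ _ _ ((Finset.card_le_univ _).trans (by simp))
  set gap : (Fin (k + 2) → Fin n) → ℤ := fun p => ((p j.succ : ℕ) : ℤ) - (p 0 : ℕ) with hgap
  have hpair (p) (hp : p ∈ crossingWalks n k j) : 2 * numValues (stepLength p) ≤ k + 1 := by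
    simp only [crossingWalks, Finset.mem_filter] at hp
    exact hp.2.1.two_mul_numValues_le
  have hgap0 (p) (hp : p ∈ crossingWalks n k j) : gap p ≠ 0 := by
    simp only [crossingWalks, Finset.mem_filter] at hp
    have h := hp.2.2.2.2
    intro h'
    replace h' : ((p j.succ : ℕ) : ℤ) - (p 0 : ℕ) = 0 := h'
    exact h (Fin.ext (by omega))
  rw [← Finset.sum_filter_add_sum_filter_not _ fun p => T ≤ (gap p).natAbs]
  refine (abs_add_le _ _).trans (add_le_add ?_ ?_)
  · have hcard := h₁ n hn ((crossingWalks n k j).filter fun p => T ≤ (gap p).natAbs)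
      fun p hp => hpair p (Finset.mem_filter.1 hp).1
    calc _ ≤ ∑ p ∈ (crossingWalks n k j).filter fun p => T ≤ (gap p).natAbs, η * C := by
          refine (Finset.abs_sum_le_sum_abs _ _).trans (Finset.sum_le_sum fun p hp => ?_)
          obtain ⟨hp, hTp⟩ := Finset.mem_filter.1 hp
          rw [ha.integral_walkWeight_of_mem_crossingWalks hj0 hp, abs_mul]
          exact mul_le_mul (hT _ hTp _) (hrw j p) (abs_nonneg _) hη.le
      _ ≤ (C₁ * Real.sqrt n ^ (k + 1 + 2)) * (η * C) := by
          rw [Finset.sum_const, nsmul_eq_mul]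
          gcongr
      _ = (C₁ * (η * C)) * Real.sqrt n ^ (k + 3) := by ring
      _ ≤ _ := by gcongr
  · set N := (crossingWalks n k j).filter fun p => ¬ T ≤ (gap p).natAbs with hN
    have hcard : (N.card : ℝ) ≤ (2 * T + 1) * (C₂ * Real.sqrt n ^ (k + 2)) := by
      rw [Finset.card_eq_sum_card_fiberwise (f := gap) (t := Finset.Icc (-T : ℤ) T)]
      · push_cast
        refine (Finset.sum_le_sum (g := fun _ => C₂ * Real.sqrt n ^ (k + 2)) fun b _ => ?_).trans ?_
        · refine h₂ n hn (fun i => if i ≤ j then 1 else 0) b _ (fun p hp => ?_) (fun p hp => ?_)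
            fun p hp => ?_
          · exact (hpair p (Finset.mem_filter.1 (Finset.mem_filter.1 hp).1).1).trans (by omega)
          · rw [sum_walkStep_of_lt]
            exact (Finset.mem_filter.1 hp).2
          · obtain ⟨i₀, hi₀⟩ := exists_class_sum_ne_zero (sum_walkStep_of_lt p j)
              (hgap0 p (Finset.mem_filter.1 (Finset.mem_filter.1 hp).1).1)
            exact ⟨i₀, Or.inr hi₀⟩
        · rw [Finset.sum_const, nsmul_eq_mul, Int.card_Icc]
          apply le_of_eq
          congr 1
          have : ((T : ℤ) + 1 - -T).toNat = 2 * T + 1 := by omega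
          rw [this]
          push_cast
          rfl
      · intro p hp
        have := (Finset.mem_filter.1 hp).2
        simp only [Finset.coe_Icc, Set.mem_Icc]
        omega
    calc _ ≤ ∑ p ∈ N, C :=
          (Finset.abs_sum_le_sum_abs _ _).trans (Finset.sum_le_sum fun p _ => hww p)
      _ ≤ ((2 * T + 1) * (C₂ * Real.sqrt n ^ (k + 2))) * C := by
          rw [Finset.sum_const, nsmul_eq_mul]
          gcongr
      _ = _ := by ring

end IsDiagonalArray

theorem tendsto_const_mul_sqrt_pow_div (C : ℝ) (m : ℕ) :
    Tendsto (fun n : ℕ => C * Real.sqrt n ^ m / Real.sqrt n ^ (m + 1)) atTop (𝓝 0) := by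
  have h : Tendsto (fun n : ℕ => C * (Real.sqrt n)⁻¹) atTop (𝓝 (C * 0)) :=
    (tendsto_inv_atTop_zero.comp
      (Real.tendsto_sqrt_atTop.comp tendsto_natCast_atTop_atTop)).const_mul C
  rw [mul_zero] at h
  refine h.congr' ?_
  filter_upwards [eventually_gt_atTop 0] with n hn
  have : 0 < Real.sqrt n := Real.sqrt_pos.2 (by exact_mod_cast hn)
  field_simp
  ring

/-- The variances of `X + Y` and `X - Y` are non-negative. Covariances are thus controlled by
variances. -/
theorem abs_integral_mul_sub_le {X Y : Ω → ℝ} (hX : Integrable X P) (hY : Integrable Y P)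
    (hXX : Integrable (fun ω => X ω * X ω) P) (hYY : Integrable (fun ω => Y ω * Y ω) P)
    (hXY : Integrable (fun ω => X ω * Y ω) P) :
    |∫ ω, X ω * Y ω ∂P - (∫ ω, X ω ∂P) * ∫ ω, Y ω ∂P| ≤
      (∫ ω, X ω * X ω ∂P - (∫ ω, X ω ∂P) * ∫ ω, X ω ∂P) +
        (∫ ω, Y ω * Y ω ∂P - (∫ ω, Y ω ∂P) * ∫ ω, Y ω ∂P) := by
  set x := ∫ ω, X ω ∂P with hx
  set y := ∫ ω, Y ω ∂P with hy
  have key (c : ℝ) : 0 ≤ (∫ ω, X ω * X ω ∂P - x * x) + c * 2 * (∫ ω, X ω * Y ω ∂P - x * y) +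
      c ^ 2 * (∫ ω, Y ω * Y ω ∂P - y * y) := by
    have h0 : 0 ≤ ∫ ω, ((X ω - x) + c * (Y ω - y)) ^ 2 ∂P := integral_nonneg fun ω => sq_nonneg _
    have h1 : ∀ ω, ((X ω - x) + c * (Y ω - y)) ^ 2 = X ω * X ω + (c * 2) * (X ω * Y ω) +
        c ^ 2 * (Y ω * Y ω) + (-(2 * x) - 2 * c * y) * X ω +
        (-(2 * c * x) - 2 * c ^ 2 * y) * Y ω + (x + c * y) ^ 2 := fun ω => by ring
    simp_rw [h1] at h0
    rw [integral_add (by fun_prop) (by fun_prop), integral_add (by fun_prop) (by fun_prop),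
      integral_add (by fun_prop) (by fun_prop), integral_add (by fun_prop) (by fun_prop),
      integral_add (by fun_prop) (by fun_prop)] at h0
    simp only [integral_const_mul, integral_const, probReal_univ, smul_eq_mul, one_mul, ← hx,
      ← hy] at h0
    linarith
  have k1 := key 1
  have k2 := key (-1)
  rw [abs_le]
  constructor <;> linarith

end Moments

/-! ### Normalized moments -/

section Normalized

theorem tracePow_zero {Ω : Type*} (a : ℕ → ℕ → Ω → ℝ) (n : ℕ) (ω : Ω) : tracePow a n 0 ω = n := by
  simp [tracePow, walkWeight, closedWalks]

theorem esdMoment_zero {Ω : Type*} (a : ℕ → ℕ → Ω → ℝ) {n : ℕ} (hn : 0 < n) (ω : Ω) :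
    esdMoment a n 0 ω = 1 := by
  rw [esdMoment_eq, tracePow_zero, zero_add, Real.sq_sqrt (Nat.cast_nonneg n), div_self]
  exact_mod_cast hn.ne'

theorem esdMoment_mul {Ω : Type*} (a : ℕ → ℕ → Ω → ℝ) (n K L : ℕ) (ω : Ω) :
    esdMoment a n K ω * esdMoment a n L ω =
      tracePow a n K ω * tracePow a n L ω / Real.sqrt n ^ (K + L + 4) := by
  rw [esdMoment_eq, esdMoment_eq, div_mul_div_comm, ← pow_add]
  ring_nf

theorem integral_esdMoment {Ω : Type*} [MeasurableSpace Ω] (P : Measure Ω)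
    (a : ℕ → ℕ → Ω → ℝ) (n K : ℕ) :
    ∫ ω, esdMoment a n K ω ∂P = (∫ ω, tracePow a n K ω ∂P) / Real.sqrt n ^ (K + 2) := by
  simp_rw [esdMoment_eq, integral_div]

variable {Ω : Type*} [MeasurableSpace Ω] {P : Measure Ω} [IsProbabilityMeasure P]
  {a : ℕ → ℕ → Ω → ℝ}

namespace IsDiagonalArray

theorem integrable_esdMoment (ha : IsDiagonalArray P a) (n K : ℕ) :
    Integrable (esdMoment a n K) P := by
  simp_rw [funext (esdMoment_eq a n K)]
  exact (ha.integrable_tracePow n K).div_const _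

theorem integrable_esdMoment_mul (ha : IsDiagonalArray P a) (n K L : ℕ) :
    Integrable (fun ω => esdMoment a n K ω * esdMoment a n L ω) P := by
  simp_rw [esdMoment_mul]
  exact (ha.integrable_tracePow_mul n K L).div_const _

theorem exists_esdMoment_variance_le (ha : IsDiagonalArray P a) (K : ℕ) :
    ∃ C : ℝ, 0 ≤ C ∧ ∀ n, 0 < n →
      ∫ ω, esdMoment a n K ω * esdMoment a n K ω ∂P -
        (∫ ω, esdMoment a n K ω ∂P) * ∫ ω, esdMoment a n K ω ∂P ≤ C / n := by
  obtain ⟨C, hC, h⟩ := ha.exists_tracePow_variance_le K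
  refine ⟨C, hC, fun n hn => ?_⟩
  have hs : 0 < Real.sqrt n := Real.sqrt_pos.2 (by exact_mod_cast hn)
  have hn' : (n : ℝ) = Real.sqrt n ^ 2 := (Real.sq_sqrt (Nat.cast_nonneg n)).symm
  simp_rw [esdMoment_mul, integral_esdMoment, integral_div]
  rw [div_mul_div_comm, ← pow_add, show K + 2 + (K + 2) = K + K + 4 by ring, ← sub_div]
  calc _ ≤ C * Real.sqrt n ^ (2 * K + 2) / Real.sqrt n ^ (K + K + 4) := by
        gcongr
        exact h n hn
    _ = C / n := by
        rw [show K + K + 4 = 2 * K + 2 + 2 by ring, pow_add _ (2 * K + 2) 2, ← hn']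
        field_simp

theorem integral_sq_sub_esdMoment (ha : IsDiagonalArray P a) (n K : ℕ) :
    ∫ ω, (esdMoment a n K ω - ∫ ω', esdMoment a n K ω' ∂P) ^ 2 ∂P =
      ∫ ω, esdMoment a n K ω * esdMoment a n K ω ∂P -
        (∫ ω, esdMoment a n K ω ∂P) * ∫ ω, esdMoment a n K ω ∂P := by
  set x := ∫ ω, esdMoment a n K ω ∂P with hx
  have h1 := ha.integrable_esdMoment n K
  have h2 := ha.integrable_esdMoment_mul n K K
  have h3 (ω : Ω) : (esdMoment a n K ω - x) ^ 2 = esdMoment a n K ω * esdMoment a n K ω +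
      (-(2 * x)) * esdMoment a n K ω + x ^ 2 := by ring
  simp_rw [h3]
  rw [integral_add (by fun_prop) (by fun_prop), integral_add (by fun_prop) (by fun_prop),
    integral_const_mul, ← hx]
  simp only [integral_const, probReal_univ, smul_eq_mul, one_mul]
  ring

/-- It allows the expected products in the recursion to be replaced by products of expectations. -/
theorem tendsto_covariance (ha : IsDiagonalArray P a) (K L : ℕ) :
    Tendsto (fun n => ∫ ω, esdMoment a n K ω * esdMoment a n L ω ∂P -
      (∫ ω, esdMoment a n K ω ∂P) * ∫ ω, esdMoment a n L ω ∂P) atTop (𝓝 0) := by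
  obtain ⟨C, hC, h⟩ := ha.exists_esdMoment_variance_le K
  obtain ⟨D, hD, h'⟩ := ha.exists_esdMoment_variance_le L
  have hlim : Tendsto (fun n : ℕ => C / (n : ℝ) + D / n) atTop (𝓝 (0 + 0)) :=
    (tendsto_const_div_atTop_nhds_zero_nat C).add (tendsto_const_div_atTop_nhds_zero_nat D)
  rw [add_zero] at hlim
  refine squeeze_zero_norm' ?_ hlim
  filter_upwards [eventually_gt_atTop 0] with n hn
  exact (abs_integral_mul_sub_le (ha.integrable_esdMoment n K) (ha.integrable_esdMoment n L)
    (ha.integrable_esdMoment_mul n K K) (ha.integrable_esdMoment_mul n L L)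
    (ha.integrable_esdMoment_mul n K L)).trans (add_le_add (h n hn) (h' n hn))

theorem tendsto_recursion_error (ha : IsDiagonalArray P a) (k : ℕ) :
    Tendsto (fun n => ∫ ω, esdMoment a n (k + 1) ω ∂P -
      ∑ i : Fin k, ∫ ω, esdMoment a n i ω * esdMoment a n (k - 1 - i) ω ∂P -
      ∑ i : Fin k, (∑ p ∈ crossingWalks n k i.succ, ∫ ω, walkWeight a p ω ∂P) /
        Real.sqrt n ^ (k + 3)) atTop (𝓝 0) := by
  obtain ⟨C, hC, h⟩ := ha.exists_integral_tracePow_succ k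
  refine squeeze_zero_norm' ?_ (tendsto_const_mul_sqrt_pow_div C (k + 2))
  filter_upwards [eventually_gt_atTop 0] with n hn
  have hs : 0 < Real.sqrt n := Real.sqrt_pos.2 (by exact_mod_cast hn)
  have he (i : Fin k) : ∫ ω, esdMoment a n i ω * esdMoment a n (k - 1 - i) ω ∂P =
      (∫ ω, tracePow a n i ω * tracePow a n (k - 1 - i) ω ∂P) / Real.sqrt n ^ (k + 3) := by
    simp_rw [esdMoment_mul, integral_div]
    congr 2
    omega
  simp_rw [he]
  rw [integral_esdMoment, ← Finset.sum_div, ← Finset.sum_div, ← sub_div, ← sub_div, norm_div,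
    Real.norm_eq_abs, Real.norm_of_nonneg (by positivity)]
  gcongr
  exact h n hn

theorem tendsto_crossingWalks (ha : IsDiagonalArray P a) (hdec : CorrDecay P a) {k : ℕ}
    {j : Fin (k + 1)} (hj0 : j ≠ 0) :
    Tendsto (fun n => (∑ p ∈ crossingWalks n k j, ∫ ω, walkWeight a p ω ∂P) /
      Real.sqrt n ^ (k + 3)) atTop (𝓝 0) := by
  rw [Metric.tendsto_nhds]
  intro ε hε
  obtain ⟨D, hD, h⟩ := ha.exists_abs_sum_crossingWalks_le hdec hj0 (half_pos hε)
  have hlim := (tendsto_const_mul_sqrt_pow_div D (k + 2)).eventually (gt_mem_nhds (half_pos hε))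
  filter_upwards [eventually_gt_atTop 0, hlim] with n hn hl
  have hs : 0 < Real.sqrt n := Real.sqrt_pos.2 (by exact_mod_cast hn)
  rw [dist_zero_right, norm_div, Real.norm_eq_abs, Real.norm_of_nonneg (by positivity)]
  calc _ ≤ (ε / 2 * Real.sqrt n ^ (k + 3) + D * Real.sqrt n ^ (k + 2)) / Real.sqrt n ^ (k + 3) := by
        gcongr
        exact h n hn
    _ = ε / 2 + D * Real.sqrt n ^ (k + 2) / Real.sqrt n ^ (k + 3) := by
        rw [add_div, mul_div_cancel_right₀ _ (by positivity)]
    _ < ε := by linarith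

/-- The expected moments of the empirical spectral distribution converge to those of the
semicircle distribution. -/
theorem tendsto_integral_esdMoment (ha : IsDiagonalArray P a) (hdec : CorrDecay P a) (K : ℕ) :
    Tendsto (fun n => ∫ ω, esdMoment a n K ω ∂P) atTop (𝓝 (semicircleMoment K)) := by
  induction K using Nat.strong_induction_on with
  | _ K ih =>
  rcases K with _ | k
  · rw [semicircleMoment_zero]
    refine tendsto_const_nhds.congr' ?_
    filter_upwards [eventually_gt_atTop 0] with n hn
    simp [esdMoment_zero a hn]
  · have h1 := ha.tendsto_recursion_error k
    have h2 : Tendsto (fun n => ∑ i : Fin k,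
        ∫ ω, esdMoment a n i ω * esdMoment a n (k - 1 - i) ω ∂P) atTop
        (𝓝 (∑ i : Fin k, semicircleMoment i * semicircleMoment (k - 1 - i))) := by
      refine tendsto_finsetSum _ fun i _ => ?_
      have := (ha.tendsto_covariance i (k - 1 - i)).add
        ((ih i (by omega)).mul (ih (k - 1 - i) (by omega)))
      simpa using this
    have h3 : Tendsto (fun n => ∑ i : Fin k, (∑ p ∈ crossingWalks n k i.succ,
        ∫ ω, walkWeight a p ω ∂P) / Real.sqrt n ^ (k + 3)) atTop (𝓝 (∑ _i : Fin k, 0)) :=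
      tendsto_finsetSum _ fun i _ => ha.tendsto_crossingWalks hdec (Fin.succ_ne_zero i)
    rw [semicircleMoment_succ, Finset.sum_range fun i => semicircleMoment i * _]
    have := (h1.add h2).add h3
    simp only [Finset.sum_const_zero, zero_add, add_zero] at this
    refine this.congr fun n => ?_
    ring

/-- Counting walks with no lone step length suffices, whatever the correlations. The case `K = 6`
controls the truncation of fourth powers. -/
theorem exists_integral_esdMoment_le (ha : IsDiagonalArray P a) (K : ℕ) :
    ∃ C : ℝ, 0 ≤ C ∧ ∀ n, 0 < n → ∫ ω, esdMoment a n K ω ∂P ≤ C := by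
  classical
  obtain ⟨C, hC, hbound⟩ := ha.exists_abs_integral_prod_le K
  obtain ⟨D, hD, h⟩ := exists_card_walks_le K K
  refine ⟨D * C, by positivity, fun n hn => ?_⟩
  have hs : 0 < Real.sqrt n := Real.sqrt_pos.2 (by exact_mod_cast hn)
  rw [integral_esdMoment, div_le_iff₀ (by positivity), ha.integral_tracePow]
  have hsum := abs_sum_le_of_support (s := closedWalks n K)
    (W := (closedWalks n K).filter fun p => NoSingleton (stepLength p))
    (f := fun p => ∫ ω, walkWeight a p ω ∂P) hC
    (fun p hp hpW => ha.integral_walkWeight_eq_zero fun hns =>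
      hpW (Finset.mem_filter.2 ⟨hp, hns⟩))
    fun p _ => hbound _ Finset.univ _ _ (by simp)
  have hcard := h n hn ((closedWalks n K).filter fun p => NoSingleton (stepLength p))
    fun p hp => by simpa using (Finset.mem_filter.1 hp).2.two_mul_numValues_le
  calc _ ≤ _ := (le_abs_self _).trans hsum
    _ ≤ (D * Real.sqrt n ^ (K + 2)) * C := by gcongr
    _ = _ := by ring

/-- Along the squares the moments are almost surely close to their expectations. -/
theorem ae_tendsto_esdMoment_sq_sub (ha : IsDiagonalArray P a) (K : ℕ) :
    ∀ᵐ ω ∂P, Tendsto (fun m : ℕ => esdMoment a ((m + 1) ^ 2) K ω -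
      ∫ ω', esdMoment a ((m + 1) ^ 2) K ω' ∂P) atTop (𝓝 0) := by
  obtain ⟨C, hC, h⟩ := ha.exists_esdMoment_variance_le K
  set Y : ℕ → Ω → ℝ := fun m ω => esdMoment a ((m + 1) ^ 2) K ω -
    ∫ ω', esdMoment a ((m + 1) ^ 2) K ω' ∂P with hY
  have hint (m : ℕ) : Integrable (fun ω => Y m ω ^ 2) P := by
    have h1 := ha.integrable_esdMoment ((m + 1) ^ 2) K
    have h2 := ha.integrable_esdMoment_mul ((m + 1) ^ 2) K K
    set x := ∫ ω', esdMoment a ((m + 1) ^ 2) K ω' ∂P with hx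
    have h3 (ω : Ω) : Y m ω ^ 2 =
        esdMoment a ((m + 1) ^ 2) K ω * esdMoment a ((m + 1) ^ 2) K ω +
        (-(2 * x)) * esdMoment a ((m + 1) ^ 2) K ω + x ^ 2 := by
      simp only [hY]
      ring
    simp_rw [h3]
    fun_prop
  have hvar (m : ℕ) : ∫ ω, Y m ω ^ 2 ∂P ≤ C / ((m + 1 : ℕ) : ℝ) ^ 2 := by
    rw [hY]
    simp only
    rw [ha.integral_sq_sub_esdMoment]
    have := h ((m + 1) ^ 2) (by positivity)
    rwa [Nat.cast_pow] at this
  -- At size `(m + 1) ^ 2` the variance is at most `C / (m + 1) ^ 2`, which is summable. So the sum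
  -- of the squared deviations is almost surely finite, and its terms tend to zero.
  have hsum : ∑' m, ∫⁻ ω, ENNReal.ofReal (Y m ω ^ 2) ∂P ≠ ∞ := by
    have hs : Summable fun m : ℕ => C / ((m + 1 : ℕ) : ℝ) ^ 2 := by
      have := (Real.summable_one_div_nat_pow.2 (by norm_num : 1 < 2)).mul_left C
      simp only [mul_one_div] at this
      exact (summable_nat_add_iff 1).2 this
    refine ne_top_of_le_ne_top (ENNReal.ofReal_ne_top (r := ∑' m : ℕ, C / ((m + 1 : ℕ) : ℝ) ^ 2)) ?_
    rw [ENNReal.ofReal_tsum_of_nonneg (fun m => by positivity) hs]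
    refine ENNReal.tsum_le_tsum fun m => ?_
    rw [← ofReal_integral_eq_lintegral_ofReal (hint m) (ae_of_all _ fun ω => sq_nonneg _)]
    exact ENNReal.ofReal_le_ofReal (hvar m)
  rw [← lintegral_tsum fun m => (hint m).1.aemeasurable.ennreal_ofReal] at hsum
  have hfin := ae_lt_top' (AEMeasurable.tsum fun m =>
    (hint m).1.aemeasurable.ennreal_ofReal) hsum
  filter_upwards [hfin] with ω hω
  have h0 := ENNReal.tendsto_atTop_zero_of_tsum_ne_top hω.ne
  have h1 := (ENNReal.tendsto_toReal ENNReal.zero_ne_top).comp h0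
  simp only [Function.comp_def, ENNReal.toReal_ofReal (sq_nonneg _), ENNReal.toReal_zero] at h1
  have h2 := (Real.continuous_sqrt.tendsto 0).comp h1
  simp only [Function.comp_def, Real.sqrt_sq_eq_abs, Real.sqrt_zero] at h2
  exact tendsto_zero_iff_abs_tendsto_zero _ |>.2 h2

end IsDiagonalArray

end Normalized

/-! ### From the squares to all sizes -/

section Interpolation

variable {Ω : Type*}

/-- The matrix of the entries, divided by `σ`. -/
noncomputable def scaledMatrix (a : ℕ → ℕ → Ω → ℝ) (n : ℕ) (σ : ℝ) (ω : Ω) :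
    Matrix (Fin n) (Fin n) ℝ := Matrix.of fun i j => entry a i j ω / σ

theorem scaledMatrix_isHermitian (a : ℕ → ℕ → Ω → ℝ) (n : ℕ) (σ : ℝ) (ω : Ω) :
    (scaledMatrix a n σ ω).IsHermitian := by
  ext i j
  simp [scaledMatrix, entry_comm a j i]

theorem trace_scaledMatrix_pow (a : ℕ → ℕ → Ω → ℝ) (n : ℕ) (σ : ℝ) (ω : Ω) (K : ℕ) :
    (scaledMatrix a n σ ω ^ K).trace = tracePow a n K ω / σ ^ K := by
  rw [trace_pow_eq_sum_closedWalks, tracePow, Finset.sum_div]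
  refine Finset.sum_congr rfl fun p _ => ?_
  simp [scaledMatrix, walkWeight, Finset.prod_div_distrib]

/-- With a common scale `σ` the smaller matrix is a principal submatrix of the larger one, and both
sums are traces of `q` of these matrices. -/
theorem sum_coeff_mul_tracePow_mono (a : ℕ → ℕ → Ω → ℝ) (ω : Ω) {q : Polynomial ℝ}
    (hconv : ConvexOn ℝ Set.univ fun x => q.eval x) (h0 : ∀ x, 0 ≤ q.eval x) {n n' : ℕ}
    (h : n ≤ n') (σ : ℝ) :
    ∑ j ∈ Finset.range (q.natDegree + 1), q.coeff j * (tracePow a n j ω / σ ^ j) ≤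
      ∑ j ∈ Finset.range (q.natDegree + 1), q.coeff j * (tracePow a n' j ω / σ ^ j) := by
  have key (l : ℕ) :
      ∑ j ∈ Finset.range (q.natDegree + 1), q.coeff j * (tracePow a l j ω / σ ^ j) =
        ∑ i, q.eval ((scaledMatrix_isHermitian a l σ ω).eigenvalues i) := by
    simp_rw [Polynomial.eval_eq_sum_range]
    rw [Finset.sum_comm]
    refine Finset.sum_congr rfl fun j _ => ?_
    rw [← Finset.mul_sum, ← trace_scaledMatrix_pow,
      trace_pow_eq_sum_eigenvalues (scaledMatrix_isHermitian a l σ ω)]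
  rw [key, key]
  refine sum_eigenvalues_submatrix_le _ _ (Fin.castLE h) (Fin.castLE_injective h) ?_ hconv h0
  ext i j
  simp [scaledMatrix]

theorem tendsto_natSqrt_atTop : Tendsto Nat.sqrt atTop atTop :=
  tendsto_atTop.2 fun b => (eventually_ge_atTop (b ^ 2)).mono fun _ hn => Nat.le_sqrt'.2 hn

theorem tendsto_natSqrt_div_sqrt :
    Tendsto (fun n : ℕ => (Nat.sqrt n : ℝ) / Real.sqrt n) atTop (𝓝 1) := by
  have hs : Tendsto (fun n : ℕ => (Real.sqrt n)⁻¹) atTop (𝓝 0) :=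
    tendsto_inv_atTop_zero.comp (Real.tendsto_sqrt_atTop.comp tendsto_natCast_atTop_atTop)
  have hl : Tendsto (fun n : ℕ => 1 - (Real.sqrt n)⁻¹) atTop (𝓝 (1 - 0)) :=
    tendsto_const_nhds.sub hs
  rw [sub_zero] at hl
  refine tendsto_of_tendsto_of_tendsto_of_le_of_le' hl tendsto_const_nhds ?_ ?_
  · filter_upwards [eventually_gt_atTop 0] with n hn
    have h : 0 < Real.sqrt n := Real.sqrt_pos.2 (by exact_mod_cast hn)
    rw [le_div_iff₀ h, sub_mul, inv_mul_cancel₀ h.ne', one_mul]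
    linarith [Real.real_sqrt_lt_nat_sqrt_succ (a := n)]
  · filter_upwards [eventually_gt_atTop 0] with n hn
    have h : 0 < Real.sqrt n := Real.sqrt_pos.2 (by exact_mod_cast hn)
    exact (div_le_one h).2 Real.nat_sqrt_le_real_sqrt

/-- Changing the scale from `√n` to `m` costs a power of `m / √n`, which tends to `1` when `m ^ 2`
is a square next to `n`. -/
theorem tracePow_div_eq (a : ℕ → ℕ → Ω → ℝ) (ω : Ω) (m n K : ℕ) (hm : 0 < m) :
    (n : ℝ)⁻¹ * (tracePow a (m ^ 2) K ω / Real.sqrt n ^ K) =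
      esdMoment a (m ^ 2) K ω * ((m : ℝ) / Real.sqrt n) ^ (K + 2) := by
  have hm' : (m : ℝ) ≠ 0 := by exact_mod_cast hm.ne'
  rw [esdMoment_eq, Nat.cast_pow, Real.sqrt_sq (Nat.cast_nonneg m), div_pow,
    div_mul_div_cancel₀ (pow_ne_zero _ hm'), pow_add, Real.sq_sqrt (Nat.cast_nonneg n)]
  rw [div_eq_mul_inv, div_eq_mul_inv, mul_inv]
  ring

theorem integral_polynomial_esd (a : ℕ → ℕ → Ω → ℝ) (n : ℕ) (ω : Ω) (q : Polynomial ℝ) :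
    ∫ x, q.eval x ∂(esd a n ω) = (n : ℝ)⁻¹ * ∑ j ∈ Finset.range (q.natDegree + 1),
      q.coeff j * (tracePow a n j ω / Real.sqrt n ^ j) := by
  rw [integral_polynomial (fun j => integrable_esd a n ω fun x => x ^ j), Finset.mul_sum]
  refine Finset.sum_congr rfl fun j _ => ?_
  rw [integral_pow_esd_eq, pow_add, Real.sq_sqrt (Nat.cast_nonneg n), div_mul_eq_div_div,
    div_eq_mul_inv _ (n : ℝ)]
  ring

/-- At scale `√n`, size `n` is squeezed between the sizes `⌊√n⌋ ^ 2` and `(⌊√n⌋ + 1) ^ 2`. -/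
theorem tendsto_integral_convex_polynomial {a : ℕ → ℕ → Ω → ℝ} {ω : Ω}
    (h : ∀ K, Tendsto (fun m : ℕ => esdMoment a ((m + 1) ^ 2) K ω) atTop
      (𝓝 (semicircleMoment K))) {q : Polynomial ℝ}
    (hconv : ConvexOn ℝ Set.univ fun x => q.eval x) (h0 : ∀ x, 0 ≤ q.eval x) :
    Tendsto (fun n => ∫ x, q.eval x ∂(esd a n ω)) atTop (𝓝 (∫ x, q.eval x ∂semicircle)) := by
  rw [integral_polynomial fun j => integrable_semicircle (by fun_prop)]
  have h' (K : ℕ) : Tendsto (fun m : ℕ => esdMoment a (m ^ 2) K ω) atTop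
      (𝓝 (semicircleMoment K)) :=
    (tendsto_add_atTop_iff_nat (f := fun m : ℕ => esdMoment a (m ^ 2) K ω) 1).1 (h K)
  have hlim (r : ℕ → ℕ) (hr : Tendsto r atTop atTop)
      (hr1 : Tendsto (fun n : ℕ => (r n : ℝ) / Real.sqrt n) atTop (𝓝 1)) :
      Tendsto (fun n : ℕ => ∑ j ∈ Finset.range (q.natDegree + 1), q.coeff j *
        (esdMoment a (r n ^ 2) j ω * ((r n : ℝ) / Real.sqrt n) ^ (j + 2))) atTop
        (𝓝 (∑ j ∈ Finset.range (q.natDegree + 1), q.coeff j * semicircleMoment j)) := by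
    refine tendsto_finsetSum _ fun j _ => Tendsto.const_mul _ ?_
    simpa using ((h' j).comp hr).mul (hr1.pow (j + 2))
  have hdiv : Tendsto (fun n : ℕ => ((Nat.sqrt n + 1 : ℕ) : ℝ) / Real.sqrt n) atTop (𝓝 1) := by
    have hs : Tendsto (fun n : ℕ => (Real.sqrt n)⁻¹) atTop (𝓝 0) :=
      tendsto_inv_atTop_zero.comp (Real.tendsto_sqrt_atTop.comp tendsto_natCast_atTop_atTop)
    have := tendsto_natSqrt_div_sqrt.add hs
    rw [add_zero] at this
    refine this.congr fun n => ?_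
    rw [Nat.cast_add, Nat.cast_one, add_div, one_div]
  refine tendsto_of_tendsto_of_tendsto_of_le_of_le'
    (hlim Nat.sqrt tendsto_natSqrt_atTop tendsto_natSqrt_div_sqrt)
    (hlim (fun n => Nat.sqrt n + 1)
      (tendsto_atTop_mono (fun n => Nat.le_succ _) tendsto_natSqrt_atTop) hdiv) ?_ ?_
  · filter_upwards [eventually_gt_atTop 0] with n hn
    simp_rw [← tracePow_div_eq a ω _ n _ (Nat.sqrt_pos.2 hn), ← mul_assoc,
      mul_comm _ (n : ℝ)⁻¹, mul_assoc]
    rw [← Finset.mul_sum, integral_polynomial_esd]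
    exact mul_le_mul_of_nonneg_left
      (sum_coeff_mul_tracePow_mono a ω hconv h0 (Nat.sqrt_le' n) _) (by positivity)
  · filter_upwards [eventually_gt_atTop 0] with n hn
    simp_rw [← tracePow_div_eq a ω _ n _ (Nat.succ_pos (Nat.sqrt n)), ← mul_assoc,
      mul_comm _ (n : ℝ)⁻¹, mul_assoc]
    rw [← Finset.mul_sum, integral_polynomial_esd]
    exact mul_le_mul_of_nonneg_left
      (sum_coeff_mul_tracePow_mono a ω hconv h0 (Nat.lt_succ_sqrt' n).le _) (by positivity)

theorem integral_add_one_pow {μ : Measure ℝ} (hint : ∀ k : ℕ, Integrable (fun x : ℝ => x ^ k) μ)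
    (N : ℕ) : ∫ x, (x + 1) ^ N ∂μ = ∑ i ∈ Finset.range (N + 1), (∫ x, x ^ i ∂μ) * N.choose i := by
  simp_rw [add_pow, one_pow, mul_one]
  rw [integral_finsetSum _ fun i _ => (hint i).mul_const _]
  simp_rw [integral_mul_const]

/-- Even powers are convex and non-negative. An odd moment is extracted from the convex polynomial
`(x + 1) ^ (2 * k + 2)`, in which `x ^ (2 * k + 1)` has coefficient `2 * k + 2` and the other terms
are even or of lower order. -/
theorem tendsto_esdMoment_of_squares {a : ℕ → ℕ → Ω → ℝ} {ω : Ω}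
    (h : ∀ K, Tendsto (fun m : ℕ => esdMoment a ((m + 1) ^ 2) K ω) atTop
      (𝓝 (semicircleMoment K))) (K : ℕ) :
    Tendsto (fun n => esdMoment a n K ω) atTop (𝓝 (semicircleMoment K)) := by
  have heven (k : ℕ) :
      Tendsto (fun n => esdMoment a n (2 * k) ω) atTop (𝓝 (semicircleMoment (2 * k))) := by
    have := tendsto_integral_convex_polynomial h (q := Polynomial.X ^ (2 * k))
      (by simpa using (even_two_mul k).convexOn_pow)
      (fun x => by simpa using (even_two_mul k).pow_nonneg x)
    simpa [esdMoment, semicircleMoment] using this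
  induction K using Nat.strong_induction_on with
  | _ K ih =>
  rcases Nat.even_or_odd' K with ⟨k, rfl | rfl⟩
  · exact heven k
  · have hconv : ConvexOn ℝ Set.univ fun x : ℝ => (x + 1) ^ (2 * (k + 1)) := by
      simpa [Function.comp_def, add_comm] using
        (even_two_mul (k + 1)).convexOn_pow.translate_right (1 : ℝ)
    have h1 := tendsto_integral_convex_polynomial h
      (q := (Polynomial.X + 1) ^ (2 * (k + 1))) (by simpa using hconv)
      (fun x => by simpa using (even_two_mul (k + 1)).pow_nonneg (x + 1))
    simp only [Polynomial.eval_pow, Polynomial.eval_add, Polynomial.eval_X,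
      Polynomial.eval_one] at h1
    have hexp {μ : Measure ℝ} (hint : ∀ k : ℕ, Integrable (fun x : ℝ => x ^ k) μ) :
        ∫ x, x ^ (2 * k + 1) ∂μ = (∫ x, (x + 1) ^ (2 * (k + 1)) ∂μ -
          ∑ i ∈ Finset.range (2 * k + 1), (∫ x, x ^ i ∂μ) * (2 * (k + 1)).choose i -
          ∫ x, x ^ (2 * (k + 1)) ∂μ) / (2 * (k + 1)) := by
      rw [integral_add_one_pow hint, show 2 * (k + 1) + 1 = 2 * k + 1 + 1 + 1 by ring,
        Finset.sum_range_succ, Finset.sum_range_succ,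
        show 2 * (k + 1) = 2 * k + 1 + 1 by ring, Nat.choose_self, Nat.choose_succ_self_right]
      have : (2 * ((k : ℝ) + 1)) ≠ 0 := by positivity
      push_cast
      field_simp
      ring
    have h2 : Tendsto (fun n => ∑ i ∈ Finset.range (2 * k + 1),
        (∫ x, x ^ i ∂(esd a n ω)) * ((2 * (k + 1)).choose i : ℝ)) atTop
        (𝓝 (∑ i ∈ Finset.range (2 * k + 1),
          (∫ x, x ^ i ∂semicircle) * ((2 * (k + 1)).choose i : ℝ))) :=
      tendsto_finsetSum _ fun i hi => (ih i (Finset.mem_range.1 hi)).mul_const _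
    have h3 := ((h1.sub h2).sub (heven (k + 1))).div_const (2 * ((k : ℝ) + 1))
    simp only [esdMoment, semicircleMoment] at h3 ⊢
    rw [hexp fun j => integrable_semicircle (by fun_prop)]
    exact h3.congr fun n => (hexp fun j => integrable_esd a n ω _).symm

end Interpolation

/-! ### The fourth moment under strong correlations -/

section FourthMoment

/-- The last step of a closed walk ends at the start. -/
theorem crossingWalks_last (n k : ℕ) : crossingWalks n k (Fin.last k) = ∅ := by
  classical
  rw [crossingWalks, Finset.filter_eq_empty_iff]
  rintro p hp ⟨-, -, -, h⟩
  exact h (Finset.mem_filter.1 hp).2.symm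

/-- A second step opposite to the first returns to the start at once. -/
theorem crossingWalks_one (n k : ℕ) : crossingWalks n (k + 1) (Fin.succ 0) = ∅ := by
  classical
  rw [crossingWalks, Finset.filter_eq_empty_iff]
  rintro p hp ⟨-, hstep, -, h⟩
  apply h
  rw [walkStep, walkStep, Fin.castSucc_zero, ← Fin.succ_castSucc, Fin.castSucc_zero] at hstep
  exact Fin.ext (by omega)

/-- The parallelogram with corner `x` and sides `y` and `z`. -/
def parallelogram {n : ℕ} (x y z : ℕ) (h : x + y + z < n) : Fin 5 → Fin n :=
  ![⟨x, by omega⟩, ⟨x + y, by omega⟩, ⟨x + y + z, h⟩, ⟨x + z, by omega⟩, ⟨x, by omega⟩]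

/-- Unequal sides `y < z` ensure two distinct step lengths, each taken exactly twice. -/
theorem parallelogram_mem_crossingWalks {n x y z : ℕ} (h : x + y + z < n) (hy : 0 < y)
    (hyz : y < z) : parallelogram x y z h ∈ crossingWalks n 3 2 := by
  have hst : walkStep (parallelogram x y z h) = ![(y : ℤ), z, -y, -z] := by
    funext i
    fin_cases i
    · simp [walkStep, parallelogram]
    · simp [walkStep, parallelogram]
    · simp [walkStep, parallelogram]
    · simp [walkStep, parallelogram]
  have hlen : stepLength (parallelogram x y z h) = ![y, z, y, z] := by
    funext i
    rw [stepLength, hst]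
    fin_cases i <;> simp
  simp only [crossingWalks, closedWalks, Finset.mem_filter, Finset.mem_univ, true_and]
  refine ⟨rfl, ⟨?_, ?_⟩, ?_, ?_, ?_⟩
  · rw [hlen]
    intro i
    fin_cases i
    · exact ⟨2, by decide, rfl⟩
    · exact ⟨3, by decide, rfl⟩
    · exact ⟨0, by decide, rfl⟩
    · exact ⟨1, by decide, rfl⟩
  · have h2 : ({y, z} : Finset ℕ) ⊆ Finset.univ.image (stepLength (parallelogram x y z h)) := by
      rw [hlen]
      intro v hv
      rcases Finset.mem_insert.1 hv with rfl | hv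
      · exact Finset.mem_image.2 ⟨0, Finset.mem_univ _, rfl⟩
      · rw [Finset.mem_singleton.1 hv]
        exact Finset.mem_image.2 ⟨1, Finset.mem_univ _, rfl⟩
    have := Finset.card_le_card h2
    rw [Finset.card_pair hyz.ne] at this
    rw [numValues]
    omega
  · rw [hst]; rfl
  · rw [hst]
    simpa using hy.ne'
  · intro h'
    have := congrArg Fin.val h'
    simp only [parallelogram] at this
    replace this : x + z = x := this
    omega

/-- With `q = n / 4`, the corner runs over `[0, q)` and the sides over `[1, q]` and `[q + 1, 2 *
q]`. The sides are then unequal and the far corner is at most `4 * q - 1`. -/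
theorem pow_three_le_card_crossingWalks (n : ℕ) : (n / 4) ^ 3 ≤ (crossingWalks n 3 2).card := by
  have hlt (t : Fin (n / 4) × Fin (n / 4) × Fin (n / 4)) :
      (t.1 : ℕ) + (t.2.1 + 1) + (n / 4 + 1 + t.2.2) < n := by
    have h1 := t.1.2
    have h2 := t.2.1.2
    have h3 := t.2.2.2
    omega
  have h := Finset.card_le_card_of_injOn (s := Finset.univ)
    (fun t : Fin (n / 4) × Fin (n / 4) × Fin (n / 4) => parallelogram _ _ _ (hlt t))
    (t := crossingWalks n 3 2)
    (fun t _ => parallelogram_mem_crossingWalks (hlt t) (Nat.succ_pos _) (by omega))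
    (by
      rintro ⟨x, y, z⟩ - ⟨x', y', z'⟩ - h
      have h0 : (x : ℕ) = x' := congrArg (fun i : Fin n => (i : ℕ)) (congrFun h 0)
      have h1 : (x : ℕ) + (y + 1) = x' + (y' + 1) := congrArg Fin.val (congrFun h 1)
      have h3 : (x : ℕ) + (n / 4 + 1 + z) = x' + (n / 4 + 1 + z') :=
        congrArg Fin.val (congrFun h 3)
      rw [Prod.mk.injEq, Prod.mk.injEq, Fin.ext_iff, Fin.ext_iff, Fin.ext_iff]
      omega)
  refine le_trans (le_of_eq ?_) h
  simp [Finset.card_univ]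
  ring

variable {Ω : Type*} [MeasurableSpace Ω] {P : Measure Ω} [IsProbabilityMeasure P]
  {a : ℕ → ℕ → Ω → ℝ}

namespace IsDiagonalArray

/-- Opposite sides lie on one diagonal, at a distance equal to the length of the other pair of
sides. -/
theorem integral_walkWeight_parallelogram (ha : IsDiagonalArray P a) {n : ℕ} {p : Fin 5 → Fin n}
    (hp : p ∈ crossingWalks n 3 2) : ∃ r t, 1 ≤ r ∧ 1 ≤ t ∧
      ∫ ω, walkWeight a p ω ∂P = corr P a r t * corr P a t r := by
  have h := ha.integral_walkWeight_of_mem_crossingWalks (by decide : (2 : Fin 4) ≠ 0) hp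
  simp only [crossingWalks, closedWalks, Finset.mem_filter, Finset.mem_univ, true_and] at hp
  obtain ⟨h0, -, hstep, hne, hgap⟩ := hp
  replace h0 : p 0 = p 4 := h0
  replace hstep : ((p 3 : ℕ) : ℤ) - (p 2 : ℕ) = -(((p 1 : ℕ) : ℤ) - (p 0 : ℕ)) := hstep
  replace hne : ((p 1 : ℕ) : ℤ) - (p 0 : ℕ) ≠ 0 := hne
  replace hgap : p 3 ≠ p 0 := hgap
  have hgap' : ((p 3 : ℕ) : ℤ) - (p 0 : ℕ) ≠ 0 := fun h => hgap (Fin.ext (by omega))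
  have hrest : ∫ ω, restWeight a (2 : Fin 4) p ω ∂P =
      corr P a (((p 3 : ℕ) : ℤ) - (p 0 : ℕ)).natAbs (((p 1 : ℕ) : ℤ) - (p 0 : ℕ)).natAbs := by
    have hcompl : ({0, 2} : Finset (Fin 4))ᶜ = {1, 3} := by decide
    have hw (ω : Ω) : restWeight a (2 : Fin 4) p ω =
        entry a (p 1) (p 2) ω * entry a (p 3) (p 4) ω := by
      rw [restWeight, hcompl, Finset.prod_pair (by decide)]
      rfl
    simp_rw [hw]
    rw [ha.integral_entry_mul_entry (by rw [← h0]; omega), ← h0]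
    congr 1
    · omega
    · omega
  refine ⟨stepLength p 0, (((p 3 : ℕ) : ℤ) - (p 0 : ℕ)).natAbs, ?_, ?_, ?_⟩
  · change 1 ≤ (((p 1 : ℕ) : ℤ) - (p 0 : ℕ)).natAbs
    omega
  · omega
  · rw [h, hrest]
    rfl

/-- If the correlations are bounded away from zero with a constant sign, then the fourth moment
stays above that of the semicircle distribution. -/
theorem exists_fourth_moment_gap (ha : IsDiagonalArray P a) (hcorr : CorrBoundedAway P a) :
    ∃ δ : ℝ, 0 < δ ∧ ∀ᶠ n in atTop,
      semicircleMoment 4 + δ ≤ ∫ ω, esdMoment a n 4 ω ∂P := by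
  obtain ⟨c, hc, hsign⟩ := hcorr
  -- A common sign makes the product positive, whichever sign it is.
  have hprod (r t : ℕ) (hr : 1 ≤ r) (ht : 1 ≤ t) : c ^ 2 ≤ corr P a r t * corr P a t r := by
    rcases hsign with h | h
    · nlinarith [h r t ht, h t r hr]
    · nlinarith [h r t ht, h t r hr]
  -- No walk of length two is crossing, so the second moment has limit `1` without any decay of
  -- correlations.
  have h2 : Tendsto (fun n => ∫ ω, esdMoment a n 2 ω ∂P) atTop (𝓝 1) := by
    have h := ha.tendsto_recursion_error 1
    have h1 := h.add_const 1
    rw [zero_add] at h1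
    refine h1.congr' ?_
    filter_upwards [eventually_gt_atTop 0] with n hn
    have hl : crossingWalks n 1 1 = ∅ := crossingWalks_last n 1
    simp [hl, esdMoment_zero a hn]
  have h4 := ha.tendsto_recursion_error 3
  -- Crossing walks give at least `c ^ 2 / 512`. From this come off three errors of size `c ^ 2 /
  -- 8192`: one from the recursion and two from the second moment, which enters twice.
  refine ⟨c ^ 2 / 1024, by positivity, ?_⟩
  have hm4 : semicircleMoment 4 = 2 := by
    rw [show 4 = 2 * 2 by norm_num, semicircleMoment_even, catalan_two]
    norm_num
  have e2 := h2.eventually (lt_mem_nhds (show 1 - c ^ 2 / 8192 < 1 by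
    have : 0 < c ^ 2 := by positivity
    linarith))
  have e4 := h4.eventually (lt_mem_nhds (show -(c ^ 2 / 8192) < 0 by
    have : 0 < c ^ 2 := by positivity
    linarith))
  filter_upwards [e2, e4, eventually_ge_atTop 4] with n h2n h4n hn
  have hn0 : 0 < n := by omega
  have hl : crossingWalks n 3 (Fin.succ 2) = ∅ := crossingWalks_last n 3
  have hf : crossingWalks n 3 (Fin.succ 0) = ∅ := crossingWalks_one n 2
  have hs2 : (Fin.succ 1 : Fin 4) = 2 := rfl
  -- Only the middle partner can cross; the retracing terms are twice the second moment and the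
  -- non-negative square of the first.
  rw [Fin.sum_univ_three, Fin.sum_univ_three, hl, hf, hs2] at h4n
  simp only [Fin.val_zero, Fin.val_one, Fin.val_two, esdMoment_zero a hn0, one_mul, mul_one,
    Finset.sum_empty, zero_div, zero_add, add_zero] at h4n
  norm_num at h4n
  have h11 : 0 ≤ ∫ ω, esdMoment a n 1 ω * esdMoment a n 1 ω ∂P :=
    integral_nonneg fun ω => mul_self_nonneg _
  have hcross : c ^ 2 / 512 ≤
      (∑ p ∈ crossingWalks n 3 2, ∫ ω, walkWeight a p ω ∂P) / Real.sqrt n ^ 6 := by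
    have hn' : Real.sqrt n ^ 6 = (n : ℝ) ^ 3 := by
      rw [show 6 = 2 * 3 by norm_num, pow_mul, Real.sq_sqrt (Nat.cast_nonneg n)]
    have hnpos : (0 : ℝ) < n := by exact_mod_cast hn0
    rw [hn', le_div_iff₀ (by positivity)]
    have hq : (n : ℝ) / 8 ≤ ((n / 4 : ℕ) : ℝ) := by
      rw [div_le_iff₀ (by norm_num)]
      have : n ≤ n / 4 * 8 := by omega
      exact_mod_cast this
    calc c ^ 2 / 512 * (n : ℝ) ^ 3 = ((n : ℝ) / 8) ^ 3 * c ^ 2 := by ring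
      _ ≤ ((n / 4 : ℕ) : ℝ) ^ 3 * c ^ 2 := by gcongr
      _ ≤ ((crossingWalks n 3 2).card : ℝ) * c ^ 2 := by
          gcongr
          exact_mod_cast pow_three_le_card_crossingWalks n
      _ = ∑ p ∈ crossingWalks n 3 2, c ^ 2 := by rw [Finset.sum_const, nsmul_eq_mul]
      _ ≤ _ := Finset.sum_le_sum fun p hp => by
          obtain ⟨r, t, hr, ht, h⟩ := ha.integral_walkWeight_parallelogram hp
          rw [h]
          exact hprod r t hr ht
  have : 0 < c ^ 2 := by positivity
  rw [hm4]
  linarith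

end IsDiagonalArray

/-! ### Truncated fourth powers -/

/-- The fourth power, truncated at `b ^ 4`. -/
noncomputable def truncatedFourthPow (b : ℝ) : ℝ →ᵇ ℝ :=
  BoundedContinuousFunction.ofNormedAddCommGroup (fun x => min (x ^ 4) (b ^ 4)) (by fun_prop)
    (b ^ 4) fun x => by
      rw [Real.norm_of_nonneg (le_min (by positivity) (by positivity))]
      exact min_le_right _ _

theorem truncatedFourthPow_apply (b x : ℝ) : truncatedFourthPow b x = min (x ^ 4) (b ^ 4) := rfl

theorem integral_truncatedFourthPow_semicircle {b : ℝ} (hb : 2 ≤ b) :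
    ∫ x, truncatedFourthPow b x ∂semicircle = semicircleMoment 4 := by
  refine integral_congr_ae ?_
  filter_upwards [semicircle_abs_le] with x hx
  rw [truncatedFourthPow_apply, min_eq_left]
  rw [← Even.pow_abs (by decide : Even 4) x]
  exact pow_le_pow_left₀ (abs_nonneg x) (hx.trans hb) 4

/-- Where the truncation acts, `x ^ 2 ≥ b ^ 2` and hence `x ^ 4 ≤ x ^ 6 / b ^ 2`. -/
theorem esdMoment_four_le {Ω : Type*} (a : ℕ → ℕ → Ω → ℝ) (n : ℕ) (ω : Ω) {b : ℝ} (hb : 0 < b) :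
    esdMoment a n 4 ω ≤ ∫ x, truncatedFourthPow b x ∂(esd a n ω) + esdMoment a n 6 ω / b ^ 2 := by
  rw [esdMoment, esdMoment, ← integral_div, ← integral_add (integrable_esd a n ω _)
    (integrable_esd a n ω _)]
  refine integral_mono (integrable_esd a n ω _) (integrable_esd a n ω _) fun x => ?_
  simp only [truncatedFourthPow_apply]
  rcases le_total (x ^ 4) (b ^ 4) with h | h
  · rw [min_eq_left h]
    have : 0 ≤ x ^ 6 / b ^ 2 := by positivity
    linarith
  · have hx : b ^ 2 ≤ x ^ 2 := by
      by_contra! hlt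
      nlinarith [sq_nonneg x, sq_nonneg b]
    have h6 : x ^ 4 ≤ x ^ 6 / b ^ 2 := by
      rw [le_div_iff₀ (by positivity), show x ^ 6 = x ^ 4 * x ^ 2 by ring]
      exact mul_le_mul_of_nonneg_left hx (by positivity)
    have : 0 ≤ min (x ^ 4) (b ^ 4) := le_min (by positivity) (by positivity)
    linarith

end FourthMoment

/-! ### Convergence and non-convergence -/

section Convergence

theorem abs_integral_esd_le {Ω : Type*} (a : ℕ → ℕ → Ω → ℝ) (n : ℕ) (ω : Ω) (f : ℝ →ᵇ ℝ) :
    |∫ x, f x ∂(esd a n ω)| ≤ ‖f‖ := by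
  rcases Nat.eq_zero_or_pos n with rfl | hn
  · simp [esd]
  · have hn' : (0 : ℝ) < n := by exact_mod_cast hn
    rw [integral_esd, abs_mul, abs_of_nonneg (by positivity), inv_mul_le_iff₀ hn']
    refine (Finset.abs_sum_le_sum_abs _ _).trans
      ((Finset.sum_le_sum (g := fun _ => ‖f‖) fun i _ => f.norm_coe_le_norm _).trans ?_)
    simp

variable {Ω : Type*} [MeasurableSpace Ω] {P : Measure Ω} [IsProbabilityMeasure P]
  {a : ℕ → ℕ → Ω → ℝ}

namespace IsDiagonalArray

theorem integrable_integral_esd (ha : IsDiagonalArray P a) (n : ℕ) (f : ℝ →ᵇ ℝ) :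
    Integrable (fun ω => ∫ x, f x ∂(esd a n ω)) P :=
  (integrable_const ‖f‖).mono'
    (measurable_integral_esd ha.measurable n f.continuous).aestronglyMeasurable
    (ae_of_all _ fun ω => abs_integral_esd_le a n ω f)

theorem ae_esdConvergesAt (ha : IsDiagonalArray P a) (hdec : CorrDecay P a) :
    ∀ᵐ ω ∂P, ESDConvergesAt a ω := by
  filter_upwards [ae_all_iff.2 ha.ae_tendsto_esdMoment_sq_sub] with ω hω
  refine esdConvergesAt_of_tendsto_moments (tendsto_esdMoment_of_squares fun K => ?_)
  have h1 : Tendsto (fun m : ℕ => (m + 1) ^ 2) atTop atTop :=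
    (tendsto_pow_atTop two_ne_zero).comp (tendsto_add_atTop_nat 1)
  have := (hω K).add ((ha.tendsto_integral_esdMoment hdec K).comp h1)
  simpa using this

/-- Dominated convergence applied to the almost sure statement, with the bound `‖f‖`. -/
theorem esdConvergesInExpectation (ha : IsDiagonalArray P a) (hdec : CorrDecay P a) :
    ESDConvergesInExpectation P a := by
  intro f
  have h := tendsto_integral_of_dominated_convergence (μ := P)
    (F := fun n ω => ∫ x, f x ∂(esd a n ω)) (f := fun _ => ∫ x, f x ∂semicircle) (fun _ => ‖f‖)
    (fun n => (ha.integrable_integral_esd n f).1) (integrable_const _)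
    (fun n => ae_of_all _ fun ω => abs_integral_esd_le a n ω f)
    ((ha.ae_esdConvergesAt hdec).mono fun ω hω => hω.tendsto_integral f)
  simpa using h

theorem exists_truncation {C δ : ℝ} (hC : 0 ≤ C) (hδ : 0 < δ) :
    ∃ b : ℝ, 2 ≤ b ∧ C / b ^ 2 < δ := by
  refine ⟨max 2 (C / δ + 1), le_max_left _ _, ?_⟩
  have h2 : (2 : ℝ) ≤ max 2 (C / δ + 1) := le_max_left _ _
  have h3 : C / δ + 1 ≤ max 2 (C / δ + 1) := le_max_right _ _
  rw [div_lt_iff₀ (by positivity)]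
  have h4 : C < δ * max 2 (C / δ + 1) := by
    have : C = δ * (C / δ) := by field_simp
    nlinarith
  nlinarith

/-- Truncation at level `b` loses at most `C / b ^ 2 < δ` of the expected fourth moment, uniformly
in `n > 0`, and for `b ≥ 2` it does not affect the semicircle. So part of the gap survives for a
bounded test function. -/
theorem not_esdConvergesInExpectation (ha : IsDiagonalArray P a) (hcorr : CorrBoundedAway P a) :
    ¬ ESDConvergesInExpectation P a := by
  intro h
  obtain ⟨δ, hδ, hgap⟩ := ha.exists_fourth_moment_gap hcorr
  obtain ⟨C, hC, h6⟩ := ha.exists_integral_esdMoment_le 6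
  obtain ⟨b, hb, hbC⟩ := exists_truncation hC hδ
  have hlim := h (truncatedFourthPow b)
  rw [integral_truncatedFourthPow_semicircle hb] at hlim
  have hle : semicircleMoment 4 + δ ≤ semicircleMoment 4 + C / b ^ 2 := by
    refine le_of_tendsto_of_tendsto tendsto_const_nhds (hlim.add_const (C / b ^ 2)) ?_
    filter_upwards [hgap, eventually_gt_atTop 0] with n hn hn0
    refine hn.trans ?_
    have h1 := ha.integrable_integral_esd n (truncatedFourthPow b)
    have h2 := (ha.integrable_esdMoment n 6).div_const (b ^ 2)
    refine (integral_mono (ha.integrable_esdMoment n 4) (h1.add h2) fun ω =>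
      esdMoment_four_le a n ω (by linarith)).trans ?_
    rw [integral_add' h1 h2, integral_div]
    gcongr
    exact h6 n hn0
  linarith

/-- Along the squares the fourth and sixth moments almost surely approach their expectations, so the
argument in expectation applies at fixed `ω`; failure along a subsequence suffices. -/
theorem ae_not_esdConvergesAt (ha : IsDiagonalArray P a) (hcorr : CorrBoundedAway P a) :
    ∀ᵐ ω ∂P, ¬ ESDConvergesAt a ω := by
  obtain ⟨δ, hδ, hgap⟩ := ha.exists_fourth_moment_gap hcorr
  obtain ⟨C, hC, h6⟩ := ha.exists_integral_esdMoment_le 6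
  obtain ⟨b, hb, hbC⟩ := exists_truncation hC hδ
  have hsq : Tendsto (fun m : ℕ => (m + 1) ^ 2) atTop atTop :=
    (tendsto_pow_atTop two_ne_zero).comp (tendsto_add_atTop_nat 1)
  filter_upwards [ha.ae_tendsto_esdMoment_sq_sub 4, ha.ae_tendsto_esdMoment_sq_sub 6]
    with ω h4 h6' hω
  have hlim := (hω.tendsto_integral (truncatedFourthPow b)).comp hsq
  rw [integral_truncatedFourthPow_semicircle hb] at hlim
  have hle : semicircleMoment 4 + δ + 0 ≤ semicircleMoment 4 + (C + 0) / b ^ 2 := by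
    refine le_of_tendsto_of_tendsto (h4.const_add (semicircleMoment 4 + δ))
      (hlim.add ((h6'.const_add C).div_const (b ^ 2))) ?_
    filter_upwards [hsq.eventually hgap] with m hm
    have h1 := esdMoment_four_le a ((m + 1) ^ 2) ω (b := b) (by linarith)
    have h2 : esdMoment a ((m + 1) ^ 2) 6 ω / b ^ 2 ≤ (C + (esdMoment a ((m + 1) ^ 2) 6 ω -
        ∫ ω', esdMoment a ((m + 1) ^ 2) 6 ω' ∂P)) / b ^ 2 := by
      gcongr
      linarith [h6 ((m + 1) ^ 2) (by positivity)]
    simp only [Function.comp_apply]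
    linarith
  rw [add_zero, add_zero] at hle
  linarith

end IsDiagonalArray

end Convergence

end ErgodicSemicircle

theorem theorem1 {Ω : Type*} [MeasurableSpace Ω] (P : Measure Ω) [IsProbabilityMeasure P]
    (a : ℕ → ℕ → Ω → ℝ) (ha : ErgodicSemicircle.IsDiagonalArray P a) :
    (ErgodicSemicircle.ErgodicDiagonals P a → ErgodicSemicircle.CorrDecay P a →
      ErgodicSemicircle.ESDConvergesInExpectation P a ∧
        ∀ᵐ ω ∂P, ErgodicSemicircle.ESDConvergesAt a ω) ∧
    (ErgodicSemicircle.CorrBoundedAway P a →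
      ¬ ErgodicSemicircle.ESDConvergesInExpectation P a ∧
        (∀ᵐ ω ∂P, ¬ ErgodicSemicircle.ESDConvergesAt a ω) ∧
        ∃ δ : ℝ, 0 < δ ∧ ∀ᶠ n in atTop,
          (∫ x, x ^ 4 ∂ErgodicSemicircle.semicircle) + δ ≤
            ∫ ω, ∫ x, x ^ 4 ∂(ErgodicSemicircle.esd a n ω) ∂P) := by
  exact ⟨fun _ hdec => ⟨ha.esdConvergesInExpectation hdec, ha.ae_esdConvergesAt hdec⟩,
    fun hcorr => ⟨ha.not_esdConvergesInExpectation hcorr, ha.ae_not_esdConvergesAt hcorr,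
      ha.exists_fourth_moment_gap hcorr⟩⟩
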